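/- **Setting.** Consider $\dot x = Y(x,t)\theta(t)+u$ on $[0,\infty)$ with $x(t)\in\mathbb R^n$, $\theta(t)\in\mathbb R^{m+n}$ and $Y(x,t)=[\,Y_h(x,t)\;\; I_n\,]$. Assume that $Y_h:\mathbb R^n\times[0,\infty)\to\mathbb R^{n\times m}$ is $C^2$ and that $Y_h$ and its derivatives of order at most two are bounded, uniformly in $t$, for $x$ in any bounded set. Assume that $\theta$ and the reference $x_d$ are twice differentiable, that $\theta,\dot\theta,\ddot\theta,x_d,\dot x_d,\ddot x_d$ are bounded, and that $\|\theta(t)\|\le\bar\theta$ with a known $\bar\theta>0$. Let $f:\mathbb R^{m+n}\to\mathbb R$ be convex and $C^1$ with $f<0$ on $\{\|\phi\|<\bar\theta\}$ and $f=0$ on $\{\|\phi\|=\bar\theta\}$. Let $\Gamma=\mathrm{diag}(\Gamma_1,\Gamma_2)$ with $\Gamma_1\in\mathbb R^{m\times m}$, $\Gamma_2\in\mathbb R^{n\times n}$ symmetric positive definite, and let $\alpha,\beta,K>0$ be constant gains. Put $e=x-x_d$, $r=\dot e+\alpha e$, $Y_d(t)=Y(x_d(t),t)$, and let $\mathrm{sgn}$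 act coordinatewise. The controller is $$u=-Y_d\hat\theta-\alpha e+\dot x_d+\mu ,$$ $$\dot{\hat\theta}=\begin{cases}\Lambda_0,&\|\hat\theta\|<\bar\theta\ \text{or}\ \nabla f(\hat\theta)^T\Lambda_0\le0,\\ \Lambda_1,&\text{otherwise,}\end{cases}\qquad \dot\mu=\begin{cases}-Kr,&\|\hat\theta\|<\bar\theta\ \text{or}\ \nabla f(\hat\theta)^T\Lambda_0\le0,\\ -Kr-Y_d(\Lambda_0-\Lambda_1),&\text{otherwise,}\end{cases}$$ $$\Lambda_0=\Gamma Y_d^T(Y_d\Gamma Y_d^T)^{-1}\beta\,\mathrm{sgn}(e),\qquad \Lambda_1=\Big(I-\tfrac{\nabla f(\hat\theta)\nabla f(\hat\theta)^T}{\|\nabla f(\hat\theta)\|^2}\Big)\Lambda_0 ,$$ with $\|\hat\theta(0)\|<\bar\theta$ and $\mu(0)=0$. A *trajectory* on $[0,T)$, $T\le\infty$, is a Filippov solution $(x,\hat\theta,\mu)$ of this closed loop. Put $z=(r,e)$ and $$N_B=Y_d\dot\theta+\dot Y_d\theta-\dot Y_d\hat\theta,\qquad \widetilde N=(\dot Y-\dot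 Y_d)\theta+(Y-Y_d)\dot\theta+e ,$$ where $\dot Y$ is the total time derivative of $Y(x(t),t)$, so that $\widetilde N$ is a function of $(t,e,r)$ depending on $\alpha$ (through $x=x_d+e$, $\dot x=\dot x_d+r-\alpha e$). **Theorem.** 1. There is $\gamma_1>0$ and, for every $\beta>0$, a $\gamma_2>0$ such that, for all $\alpha,K>0$, every trajectory satisfies $\|N_B\|\le\gamma_1$ and, almost everywhere, $\|\dot N_B\|\le\gamma_2$. For every $\alpha>0$ there is a positive, strictly increasing, continuous, unbounded $\rho:[0,\infty)\to\mathbb R$ with $\|\widetilde N\|\le\rho(\|z\|)\|z\|$ for all $t\ge 0$ and all $e,r\in\mathbb R^n$. 2. Let $\alpha,\beta,\gamma_1,\gamma_2>0$ satisfy the gain condition $\beta>\gamma_1+\gamma_2/\alpha$, and consider only trajectories with $\|N_B\|\le\gamma_1$ and, almost everywhere, $\|\dot N_B\|\le\gamma_2$. (a) (Region of attraction.) Let $K>0$, let $\rho$ be as in 1 for this $\alpha$, and put $\|y(0)\|^2=\|z(0)\|^2+\beta\sum_i|e_i(0)|-e(0)^TN_B(0)$. If a trajectory satisfies $\tfrac12\rho\big(\sqrt2\,\|y(0)\|\big)^2<\min\{\alpha,K-\tfrac12\}$,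 then all its closed-loop signals ($x,\dot x,e,r,u,\mu,\hat\theta,\theta-\hat\theta,Y,Y_d$ and, almost everywhere, $\dot{\hat\theta},\dot\mu$) are bounded on $[0,T)$, with $\|\hat\theta\|\le\bar\theta$, and if $T=\infty$ then $\|e(t)\|\to0$ as $t\to\infty$. (b) (Semi-global asymptotic tracking.) For every $R>0$ there is $K_0>0$ such that for every $K\ge K_0$ there is a constant $M$, independent of the trajectory and of $T$, such that every trajectory with $\|e(0)\|\le R$ has $\|\hat\theta\|\le\bar\theta$ and all its closed-loop signals bounded by $M$ on $[0,T)$ (so there is no finite escape), and if $T=\infty$ then $\|e(t)\|\to0$ as $t\to\infty$. -/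

import Mathlib

open Set MeasureTheory Filter Topology
open scoped Matrix

noncomputable section

/-- Coordinate vectors with the Euclidean norm. -/
abbrev Vec (ι : Type) [Fintype ι] := EuclideanSpace ℝ ι

/-- Matrix times vector, on Euclidean spaces. -/
def matVec {ι κ : Type} [Fintype ι] [Fintype κ] (A : Matrix ι κ ℝ) (v : Vec κ) : Vec ι :=
  WithLp.toLp 2 (A *ᵥ WithLp.ofLp v)

/-- The coordinatewise signum `sgn(v)` (with `sgn(0) = 0`). -/
def sgnVec {ι : Type} [Fintype ι] (v : Vec ι) : Vec ι :=
  WithLp.toLp 2 fun i => Real.sign (v i)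

/-- Filippov's set-valued regularization of a (discontinuous) vector field `g`:
`K[g](t, w) = ⋂_{δ > 0} ⋂_{|N| = 0} cl conv g(t, B(w, δ) \ N)`, where `N` runs over the
Lebesgue null sets of the state space. -/
def filippovMap {E : Type} [NormedAddCommGroup E] [NormedSpace ℝ E] [MeasureSpace E]
    (g : ℝ → E → E) (t : ℝ) (w : E) : Set E :=
  ⋂ (δ : ℝ) (_ : 0 < δ) (N : Set E) (_ : volume N = 0),
    closure (convexHull ℝ (g t '' (Metric.ball w δ \ N)))

/-- The time interval `[0, T)`, where `T = ⊤` gives `[0, ∞)`. -/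
def timeInterval (T : EReal) : Set ℝ := {t | 0 ≤ t ∧ (t : EReal) < T}

/-- `w` is a Filippov solution of `ẇ = g(t, w)` on `[0, T)`: it is absolutely continuous on
compact subintervals and `ẇ(t) ∈ K[g](t, w(t))` for almost every `t`. -/
def IsFilippovSolution {E : Type} [NormedAddCommGroup E] [NormedSpace ℝ E] [MeasureSpace E]
    (g : ℝ → E → E) (T : EReal) (w : ℝ → E) : Prop :=
  (∀ b ∈ timeInterval T, AbsolutelyContinuousOnInterval w 0 b) ∧
  ∀ᵐ t : ℝ, t ∈ timeInterval T → ∃ v ∈ filippovMap g t (w t), HasDerivAt w v t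

/-- The data of the control problem: the regression matrix `Y_h(x, t)`, the augmented
time-varying parameter `θ = (θ_f, d)`, the reference `x_d`, the radius `θ̄` of the projection
ball, the function `f` describing its boundary, and the two diagonal blocks of `Γ`. -/
structure AdaptiveSystem (n m : ℕ) where
  Yh : Vec (Fin n) → ℝ → Matrix (Fin n) (Fin m) ℝ
  θ : ℝ → Vec (Fin m ⊕ Fin n)
  xd : ℝ → Vec (Fin n)
  θbar : ℝ
  f : Vec (Fin m ⊕ Fin n) → ℝ
  Γ₁ : Matrix (Fin m) (Fin m) ℝ
  Γ₂ : Matrix (Fin n) (Fin n) ℝ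

/-- The constant gains `α`, `β`, `K`. -/
structure Gains where
  α : ℝ
  β : ℝ
  K : ℝ

namespace AdaptiveSystem

variable {n m : ℕ}

/-- Time derivative of the parameter. -/
def θ' (S : AdaptiveSystem n m) : ℝ → Vec (Fin m ⊕ Fin n) := derivWithin S.θ (Ici 0)

/-- Time derivative of the reference. -/
def xd' (S : AdaptiveSystem n m) : ℝ → Vec (Fin n) := derivWithin S.xd (Ici 0)

/-- The standing assumptions on the data. -/
structure Assumptions (S : AdaptiveSystem n m) : Prop where
  /-- The entries of `Y_h` are twice continuously differentiable on `ℝⁿ × [0, ∞)`. -/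
  Yh_contDiff : ∀ i j, ContDiffOn ℝ 2 (fun p : Vec (Fin n) × ℝ => S.Yh p.1 p.2 i j)
    (univ ×ˢ Ici 0)
  /-- `Y_h` and its derivatives of order at most two are bounded for bounded `x`,
  uniformly in time. -/
  Yh_bounded : ∀ R : ℝ, ∃ C : ℝ, ∀ i j, ∀ k : ℕ, k ≤ 2 → ∀ x t, ‖x‖ ≤ R → 0 ≤ t →
    ‖iteratedFDerivWithin ℝ k (fun p : Vec (Fin n) × ℝ => S.Yh p.1 p.2 i j)
      (univ ×ˢ Ici 0) (x, t)‖ ≤ C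
  θbar_pos : 0 < S.θbar
  θ_diff : DifferentiableOn ℝ S.θ (Ici 0)
  θ'_diff : DifferentiableOn ℝ S.θ' (Ici 0)
  θ_le : ∀ t, 0 ≤ t → ‖S.θ t‖ ≤ S.θbar
  θ'_le : ∃ ζ₁ : ℝ, ∀ t, 0 ≤ t → ‖S.θ' t‖ ≤ ζ₁
  θ''_le : ∃ ζ₂ : ℝ, ∀ t, 0 ≤ t → ‖derivWithin S.θ' (Ici 0) t‖ ≤ ζ₂
  xd_diff : DifferentiableOn ℝ S.xd (Ici 0)
  xd'_diff : DifferentiableOn ℝ S.xd' (Ici 0)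
  xd_le : ∃ c : ℝ, ∀ t, 0 ≤ t → ‖S.xd t‖ ≤ c
  xd'_le : ∃ δ₁ : ℝ, ∀ t, 0 ≤ t → ‖S.xd' t‖ ≤ δ₁
  xd''_le : ∃ δ₂ : ℝ, ∀ t, 0 ≤ t → ‖derivWithin S.xd' (Ici 0) t‖ ≤ δ₂
  f_contDiff : ContDiff ℝ 1 S.f
  f_convex : ConvexOn ℝ univ S.f
  f_neg : ∀ φ, ‖φ‖ < S.θbar → S.f φ < 0
  f_zero : ∀ φ, ‖φ‖ = S.θbar → S.f φ = 0
  Γ₁_posDef : S.Γ₁.PosDef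
  Γ₂_posDef : S.Γ₂.PosDef

variable (S : AdaptiveSystem n m)

/-- The augmented regressor `Y(x, t) = [Y_h(x, t)  I_n]`. -/
def Y (x : Vec (Fin n)) (t : ℝ) : Matrix (Fin n) (Fin m ⊕ Fin n) ℝ :=
  Matrix.fromCols (S.Yh x t) 1

/-- The desired regressor `Y_d(t) = Y(x_d(t), t)`. -/
def Yd (t : ℝ) : Matrix (Fin n) (Fin m ⊕ Fin n) ℝ := S.Y (S.xd t) t

/-- The total time derivative of `Y(x(t), t)` at a time where `x(t) = x` and `ẋ(t) = v`. -/
def Ydot (x v : Vec (Fin n)) (t : ℝ) : Matrix (Fin n) (Fin m ⊕ Fin n) ℝ :=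
  Matrix.of fun i j =>
    fderivWithin ℝ (fun p : Vec (Fin n) × ℝ => S.Y p.1 p.2 i j) (univ ×ˢ Ici 0) (x, t) (v, 1)

/-- `Ẏ_d`, the time derivative of `Y_d`. -/
def Yddot (t : ℝ) : Matrix (Fin n) (Fin m ⊕ Fin n) ℝ := S.Ydot (S.xd t) (S.xd' t) t

/-- The block diagonal adaptation gain. -/
def Γ : Matrix (Fin m ⊕ Fin n) (Fin m ⊕ Fin n) ℝ := Matrix.fromBlocks S.Γ₁ 0 0 S.Γ₂

/-- The tracking error `e = x - x_d`. -/
def e (t : ℝ) (x : Vec (Fin n)) : Vec (Fin n) := x - S.xd t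

/-- `Λ₀ = Γ Y_dᵀ (Y_d Γ Y_dᵀ)⁻¹ (β sgn(e))`. -/
def Λ₀ (G : Gains) (t : ℝ) (x : Vec (Fin n)) : Vec (Fin m ⊕ Fin n) :=
  matVec (S.Γ * (S.Yd t)ᵀ * (S.Yd t * S.Γ * (S.Yd t)ᵀ)⁻¹) (G.β • sgnVec (S.e t x))

/-- `Λ₁ = (I - ∇f(θ̂) ∇f(θ̂)ᵀ / ‖∇f(θ̂)‖²) Λ₀`. -/
def Λ₁ (G : Gains) (t : ℝ) (x : Vec (Fin n)) (θhat : Vec (Fin m ⊕ Fin n)) :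
    Vec (Fin m ⊕ Fin n) :=
  S.Λ₀ G t x -
    (inner ℝ (gradient S.f θhat) (S.Λ₀ G t x) / ‖gradient S.f θhat‖ ^ 2) • gradient S.f θhat

/-- The first case of the projection: `‖θ̂‖ < θ̄` or `∇f(θ̂)ᵀ Λ₀ ≤ 0`. -/
def Unprojected (G : Gains) (t : ℝ) (x : Vec (Fin n)) (θhat : Vec (Fin m ⊕ Fin n)) : Prop :=
  ‖θhat‖ < S.θbar ∨ inner ℝ (gradient S.f θhat) (S.Λ₀ G t x) ≤ 0

/-- The control `u = -Y_d θ̂ - α e + ẋ_d + μ`. -/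
def u (G : Gains) (t : ℝ) (x : Vec (Fin n)) (θhat : Vec (Fin m ⊕ Fin n)) (μ : Vec (Fin n)) :
    Vec (Fin n) :=
  -matVec (S.Yd t) θhat - G.α • S.e t x + S.xd' t + μ

/-- The plant under this control: `ẋ = Y(x, t) θ(t) + u`. -/
def xdot (G : Gains) (t : ℝ) (x : Vec (Fin n)) (θhat : Vec (Fin m ⊕ Fin n)) (μ : Vec (Fin n)) :
    Vec (Fin n) :=
  matVec (S.Y x t) (S.θ t) + S.u G t x θhat μ

/-- The filtered tracking error `r = ė + α e`, where `ė = ẋ - ẋ_d`. -/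
def r (G : Gains) (t : ℝ) (x : Vec (Fin n)) (θhat : Vec (Fin m ⊕ Fin n)) (μ : Vec (Fin n)) :
    Vec (Fin n) :=
  (S.xdot G t x θhat μ - S.xd' t) + G.α • S.e t x

open Classical in
/-- The adaptation law for `θ̂`. -/
def θhatdot (G : Gains) (t : ℝ) (x : Vec (Fin n)) (θhat : Vec (Fin m ⊕ Fin n)) :
    Vec (Fin m ⊕ Fin n) :=
  if S.Unprojected G t x θhat then S.Λ₀ G t x else S.Λ₁ G t x θhat

open Classical in
/-- The law for the auxiliary term `μ`. -/
def μdot (G : Gains) (t : ℝ) (x : Vec (Fin n)) (θhat : Vec (Fin m ⊕ Fin n)) (μ : Vec (Fin n)) :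
    Vec (Fin n) :=
  if S.Unprojected G t x θhat then -(G.K • S.r G t x θhat μ)
  else -(G.K • S.r G t x θhat μ) - matVec (S.Yd t) (S.Λ₀ G t x - S.Λ₁ G t x θhat)

/-- The discontinuous closed-loop vector field on the state `(x, θ̂, μ)`. -/
def closedLoop (G : Gains) (t : ℝ) (w : Vec (Fin n) × Vec (Fin m ⊕ Fin n) × Vec (Fin n)) :
    Vec (Fin n) × Vec (Fin m ⊕ Fin n) × Vec (Fin n) :=
  (S.xdot G t w.1 w.2.1 w.2.2, S.θhatdot G t w.1 w.2.1, S.μdot G t w.1 w.2.1 w.2.2)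

/-- `(x, θ̂, μ)` is a closed-loop trajectory on `[0, T)`: a Filippov solution with
`‖θ̂(0)‖ < θ̄` and `μ(0) = 0` (and `x(0)` arbitrary). -/
structure IsTrajectory (G : Gains) (T : EReal) (x : ℝ → Vec (Fin n))
    (θhat : ℝ → Vec (Fin m ⊕ Fin n)) (μ : ℝ → Vec (Fin n)) : Prop where
  solution : IsFilippovSolution (S.closedLoop G) T fun t => (x t, θhat t, μ t)
  θhat_zero : ‖θhat 0‖ < S.θbar
  μ_zero : μ 0 = 0

/-- `N_B = Y_d θ̇ + Ẏ_d θ - Ẏ_d θ̂`. -/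
def NB (t : ℝ) (θhat : Vec (Fin m ⊕ Fin n)) : Vec (Fin n) :=
  matVec (S.Yd t) (S.θ' t) + matVec (S.Yddot t) (S.θ t) - matVec (S.Yddot t) θhat

/-- `‖N_B‖ ≤ γ₁` and (almost everywhere) `‖Ṅ_B‖ ≤ γ₂` along a trajectory on `[0, T)`. -/
structure NBBound (γ₁ γ₂ : ℝ) (T : EReal) (θhat : ℝ → Vec (Fin m ⊕ Fin n)) : Prop where
  le : ∀ t ∈ timeInterval T, ‖S.NB t (θhat t)‖ ≤ γ₁
  deriv_le : ∀ᵐ t : ℝ, t ∈ timeInterval T →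
    DifferentiableAt ℝ (fun s => S.NB s (θhat s)) t ∧
    ‖deriv (fun s => S.NB s (θhat s)) t‖ ≤ γ₂

/-- `Ñ = (Ẏ - Ẏ_d) θ + (Y - Y_d) θ̇ + e` as a function of time and the errors `e`, `r`; here
`x = x_d + e` and `ẋ = ẋ_d + r - α e`. -/
def Ntilde (α : ℝ) (t : ℝ) (e r : Vec (Fin n)) : Vec (Fin n) :=
  matVec (S.Ydot (S.xd t + e) (S.xd' t + r - α • e) t - S.Yddot t) (S.θ t)
    + matVec (S.Y (S.xd t + e) t - S.Yd t) (S.θ' t) + e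

/-- `‖z‖`, where `z = (r, e)`. -/
def znorm (e r : Vec (Fin n)) : ℝ := Real.sqrt (‖r‖ ^ 2 + ‖e‖ ^ 2)

/-- `ρ` is positive, strictly increasing and onto `[ρ(0), ∞)` as a function on `[0, ∞)`, and
`‖Ñ‖ ≤ ρ(‖z‖) ‖z‖`. -/
structure IsGrowthBound (α : ℝ) (ρ : ℝ → ℝ) : Prop where
  pos : ∀ s, 0 ≤ s → 0 < ρ s
  strictMono : StrictMonoOn ρ (Ici 0)
  continuous : ContinuousOn ρ (Ici 0)
  unbounded : Tendsto ρ atTop atTop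
  le : ∀ t e r, 0 ≤ t → ‖S.Ntilde α t e r‖ ≤ ρ (znorm e r) * znorm e r

/-- `‖y(0)‖` for `y = (z, √P)`, where `P(0) = β ∑ |e_i(0)| - e(0)ᵀ N_B(0)`, in terms of the
initial values of `x`, `θ̂` and `μ`. -/
def y0norm (G : Gains) (x₀ : Vec (Fin n)) (θhat₀ : Vec (Fin m ⊕ Fin n)) (μ₀ : Vec (Fin n)) : ℝ :=
  Real.sqrt (znorm (S.e 0 x₀) (S.r G 0 x₀ θhat₀ μ₀) ^ 2 +
    (G.β * ∑ i, |S.e 0 x₀ i| - inner ℝ (S.e 0 x₀) (S.NB 0 θhat₀)))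

/-- All closed-loop signals are bounded by `M` on `[0, T)`. -/
structure SignalsBounded (G : Gains) (M : ℝ) (T : EReal) (x : ℝ → Vec (Fin n))
    (θhat : ℝ → Vec (Fin m ⊕ Fin n)) (μ : ℝ → Vec (Fin n)) : Prop where
  x_le : ∀ t ∈ timeInterval T, ‖x t‖ ≤ M
  xdot_le : ∀ t ∈ timeInterval T, ‖S.xdot G t (x t) (θhat t) (μ t)‖ ≤ M
  e_le : ∀ t ∈ timeInterval T, ‖S.e t (x t)‖ ≤ M
  r_le : ∀ t ∈ timeInterval T, ‖S.r G t (x t) (θhat t) (μ t)‖ ≤ M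
  u_le : ∀ t ∈ timeInterval T, ‖S.u G t (x t) (θhat t) (μ t)‖ ≤ M
  μ_le : ∀ t ∈ timeInterval T, ‖μ t‖ ≤ M
  θhat_le : ∀ t ∈ timeInterval T, ‖θhat t‖ ≤ S.θbar
  θtilde_le : ∀ t ∈ timeInterval T, ‖S.θ t - θhat t‖ ≤ M
  Y_le : ∀ t ∈ timeInterval T, ∀ i j, |S.Y (x t) t i j| ≤ M
  Yd_le : ∀ t ∈ timeInterval T, ∀ i j, |S.Yd t i j| ≤ M
  θhatdot_le : ∀ᵐ t : ℝ, t ∈ timeInterval T → ‖deriv θhat t‖ ≤ M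
  μdot_le : ∀ᵐ t : ℝ, t ∈ timeInterval T → ‖deriv μ t‖ ≤ M

end AdaptiveSystem

end

/-! The proof is a Lyapunov argument for V = ‖z‖²/2 + P with P = β ∑ |e_i| - eᵀN_B (`lyap`). Three
cancellations carry it.

The first removes the switching of the projection. Since Y_d Λ₀ = β sgn(e), the combination Y_d θ̂'
- μ' equals K r + β sgn(e) in both branches of the laws (`Yd_θhatdot_sub_μdot`). Only this
combination enters r', so after Filippov regularization r' = Ñ + N_B - e - K r - β ξ, where ξ_i lies
in [-1, 1] and equals sgn(e_i) wherever e_i ≠ 0 (`mem_filippovMap_closedLoop`, `hasDerivAt_r`).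

The second removes the terms rᵀ(N_B - β ξ) from V': the derivative of P, computed with e' = r - α e,
cancels them. What remains is eᵀ(α N_B - N_B') - αβ ξᵀe, which is nonpositive by the gain condition
because ξᵀe = ∑ |e_i| ≥ ‖e‖. The cross terms rᵀe cancel as well (`hasDerivAt_lyap_le`).

Finally ‖Ñ‖ ≤ ρ(‖z‖)‖z‖ is absorbed by the damping while ‖z‖ stays in a fixed ball, so there V' ≤
-κ‖z‖² (`DecayOn`). As P ≥ 0, ‖z‖² ≤ 2V(t) ≤ 2V(0) ≤ 2‖y(0)‖², and a continuity argument keeps z in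
the ball (`znorm_le`). An argument of Barbalat type then gives e → 0 (`tendsto_norm_e`).

Solutions are only absolutely continuous, so every differential inequality holds almost everywhere
and is integrated by the fundamental theorem of calculus. The generalized chain rule for |e_i|
reduces to an elementary remark on times where both e_i and |e_i| are differentiable
(`hasDerivAt_abs_comp_eq`). -/

noncomputable section

/-! ### Absolutely continuous functions and derivatives almost everywhere. -/

section AbsolutelyContinuous

namespace AbsolutelyContinuousOnInterval

theorem comp_lipschitzOnWith {X Z : Type*} [PseudoMetricSpace X] [PseudoMetricSpace Z]
    {f : ℝ → X} {g : X → Z} {s : Set X} {C : NNReal} {a b : ℝ}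
    (hg : LipschitzOnWith C g s) (hf : AbsolutelyContinuousOnInterval f a b)
    (hs : MapsTo f (uIcc a b) s) : AbsolutelyContinuousOnInterval (fun t => g (f t)) a b := by
  unfold AbsolutelyContinuousOnInterval at hf ⊢
  refine squeeze_zero' (Eventually.of_forall fun E => Finset.sum_nonneg fun i _ => dist_nonneg)
    ?_ (by simpa using hf.const_mul (C : ℝ))
  rw [eventually_inf_principal]
  refine Eventually.of_forall fun E hE => ?_
  rw [Finset.mul_sum]
  exact Finset.sum_le_sum fun i hi =>
    hg.dist_le_mul _ (hs (hE.1 i hi).1) _ (hs (hE.1 i hi).2)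

theorem prodMk {X Z : Type*} [PseudoMetricSpace X] [PseudoMetricSpace Z]
    {f : ℝ → X} {g : ℝ → Z} {a b : ℝ} (hf : AbsolutelyContinuousOnInterval f a b)
    (hg : AbsolutelyContinuousOnInterval g a b) :
    AbsolutelyContinuousOnInterval (fun t => (f t, g t)) a b := by
  unfold AbsolutelyContinuousOnInterval at hf hg ⊢
  refine squeeze_zero (fun E => Finset.sum_nonneg fun i _ => dist_nonneg)
    (fun E => ?_) (by simpa using hf.add hg)
  rw [← Finset.sum_add_distrib]
  refine Finset.sum_le_sum fun i _ => ?_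
  rw [Prod.dist_eq]
  exact max_le_add_of_nonneg dist_nonneg dist_nonneg

theorem comp_lipschitzWith {X Z : Type*} [PseudoMetricSpace X] [PseudoMetricSpace Z]
    {f : ℝ → X} {g : X → Z} {C : NNReal} {a b : ℝ}
    (hg : LipschitzWith C g) (hf : AbsolutelyContinuousOnInterval f a b) :
    AbsolutelyContinuousOnInterval (fun t => g (f t)) a b :=
  hf.comp_lipschitzOnWith (hg.lipschitzOnWith (s := univ)) (mapsTo_univ _ _)

theorem coord {ι : Type} [Fintype ι] {f : ℝ → Vec ι} {a b : ℝ}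
    (hf : AbsolutelyContinuousOnInterval f a b) (i : ι) :
    AbsolutelyContinuousOnInterval (fun t => f t i) a b :=
  hf.comp_lipschitzWith (EuclideanSpace.proj (𝕜 := ℝ) i).lipschitz

theorem fun_sum {ι : Type*} (s : Finset ι) {f : ι → ℝ → ℝ} {a b : ℝ}
    (hf : ∀ i ∈ s, AbsolutelyContinuousOnInterval (f i) a b) :
    AbsolutelyContinuousOnInterval (fun t => ∑ i ∈ s, f i t) a b := by
  classical
  induction s using Finset.induction_on with
  | empty =>
    simpa using ((LipschitzWith.const (0 : ℝ)).lipschitzOnWith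
      (s := uIcc a b)).absolutelyContinuousOnInterval
  | insert i s hi ih =>
    simp only [Finset.sum_insert hi]
    exact (hf i (Finset.mem_insert_self i s)).fun_add
      (ih fun j hj => hf j (Finset.mem_insert_of_mem hj))

/-- This replaces the mean value inequality, which fails for derivative bounds known only almost
everywhere. Every differential inequality along trajectories is integrated through it. -/
theorem sub_le_of_ae_hasDerivAt_le {f : ℝ → ℝ} {a b c : ℝ} (hab : a ≤ b)
    (hf : AbsolutelyContinuousOnInterval f a b)
    (h : ∀ᵐ t : ℝ, t ∈ Ioo a b → ∃ d, HasDerivAt f d t ∧ d ≤ c) : f b - f a ≤ c * (b - a) := by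
  rw [← hf.integral_deriv_eq_sub]
  calc ∫ t in a..b, deriv f t ≤ ∫ _ in a..b, c := by
        refine intervalIntegral.integral_mono_ae_restrict hab hf.intervalIntegrable_deriv
          intervalIntegrable_const ?_
        have : ∀ᵐ t : ℝ, t ∈ Icc a b → t ∈ Ioo a b := by
          have h1 : ∀ᵐ t : ℝ, t ≠ a := by simp [ae_iff, measure_singleton]
          have h2 : ∀ᵐ t : ℝ, t ≠ b := by simp [ae_iff, measure_singleton]
          filter_upwards [h1, h2] with t h1 h2 ht
          exact ⟨lt_of_le_of_ne ht.1 h1.symm, lt_of_le_of_ne ht.2 h2⟩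
        refine (ae_restrict_iff' measurableSet_Icc).2 ?_
        filter_upwards [h, this] with t h1 h2 ht
        obtain ⟨d, hd, hdc⟩ := h1 (h2 ht)
        rw [hd.deriv]
        exact hdc
    _ = c * (b - a) := by simp [mul_comm]

end AbsolutelyContinuousOnInterval

end AbsolutelyContinuous

/-- At a zero of `f` the function |f| has a minimum, so its derivative is 0. Then |f|, hence `f`, is
o(s - t), and `d` vanishes too. So the value of `ξ` there is irrelevant, which is why any Filippov
selection of the signum can be used. -/
theorem hasDerivAt_abs_comp_eq {f : ℝ → ℝ} {d p ξ t : ℝ} (hf : HasDerivAt f d t)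
    (hp : HasDerivAt (fun s => |f s|) p t) (hξ : f t ≠ 0 → ξ = Real.sign (f t)) :
    p = ξ * d := by
  rcases lt_trichotomy (f t) 0 with h | h | h
  · rw [hξ h.ne, Real.sign_of_neg h]
    have : HasDerivAt (fun s => |f s|) (-d) t :=
      hf.neg.congr_of_eventuallyEq <| by
        filter_upwards [hf.continuousAt.eventually_lt continuousAt_const h] with s hs
        simp [abs_of_neg hs]
    rw [hp.unique this]; ring
  · have hmin : IsLocalMin (fun s => |f s|) t :=
      Eventually.of_forall fun s => by simp [h]
    have hp0 : p = 0 := hmin.hasDerivAt_eq_zero hp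
    have hd0 : HasDerivAt f 0 t := by
      rw [hp0] at hp
      rw [hasDerivAt_iff_isLittleO] at hp ⊢
      have := hp.norm_left
      rw [← Asymptotics.isLittleO_norm_left]
      simpa [h] using this
    rw [hp0, hf.unique hd0, mul_zero]
  · rw [hξ h.ne', Real.sign_of_pos h]
    have : HasDerivAt (fun s => |f s|) d t :=
      hf.congr_of_eventuallyEq <| by
        filter_upwards [continuousAt_const.eventually_lt hf.continuousAt h] with s hs
        simp [abs_of_pos hs]
    rw [hp.unique this]; ring

/-! ### What can be read off from Filippov's regularization. -/

section Filippov

variable {E : Type} [NormedAddCommGroup E] [NormedSpace ℝ E] [MeasureSpace E]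

/-- Closed convex constraints on the field near `w` survive the closed convex hull. The exceptional
null set can be taken empty because the constraints hold at every nearby point. -/
theorem mem_of_mem_filippovMap {g : ℝ → E → E} {t : ℝ} {w v : E} {s : Set E}
    (hv : v ∈ filippovMap g t w) (hs : IsClosed s) (hc : Convex ℝ s)
    (h : ∀ᶠ w' in 𝓝 w, g t w' ∈ s) : v ∈ s := by
  obtain ⟨δ, hδ, h⟩ := Metric.eventually_nhds_iff_ball.1 h
  have := mem_iInter.1 (mem_iInter.1 (mem_iInter.1 (mem_iInter.1 hv δ) hδ) ∅) measure_empty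
  refine closure_minimal (convexHull_min ?_ hc) hs this
  rintro _ ⟨w', hw', rfl⟩
  exact h w' hw'.1

theorem le_of_mem_filippovMap {g : ℝ → E → E} {t : ℝ} {w v : E} {c : ℝ} (l : E →L[ℝ] ℝ)
    (hv : v ∈ filippovMap g t w) (h : ∀ ε > 0, ∀ᶠ w' in 𝓝 w, l (g t w') ≤ c + ε) :
    l v ≤ c := by
  refine le_of_forall_pos_le_add fun ε hε => ?_
  exact mem_of_mem_filippovMap (s := {z | l z ≤ c + ε}) hv
    (isClosed_le l.continuous continuous_const)
    (convex_halfSpace_le l.isLinear _) (h ε hε)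

/-- A linear functional of the field that is continuous at `w` is not affected by the
regularization, even if the field itself jumps. -/
theorem eq_of_mem_filippovMap {g : ℝ → E → E} {t : ℝ} {w v : E} {φ : E → ℝ} (l : E →L[ℝ] ℝ)
    (hv : v ∈ filippovMap g t w) (hφ : ContinuousAt φ w) (h : ∀ᶠ w' in 𝓝 w, l (g t w') = φ w') :
    l v = φ w := by
  refine le_antisymm (le_of_mem_filippovMap l hv fun ε hε => ?_) ?_
  · filter_upwards [h, hφ.eventually_lt continuousAt_const (lt_add_of_pos_right _ hε)]
      with w' h1 h2
    exact h1 ▸ h2.le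
  · refine neg_le_neg_iff.1 (le_of_mem_filippovMap (-l) hv fun ε hε => ?_)
    filter_upwards [h, continuousAt_const.eventually_lt hφ (sub_lt_self _ hε)] with w' h1 h2
    simp only [_root_.neg_apply, h1]
    linarith

end Filippov

/-! ### Matrices acting on Euclidean vectors. -/

section MatVec

variable {ι κ : Type} [Fintype ι] [Fintype κ]

@[simp] theorem matVec_apply (A : Matrix ι κ ℝ) (v : Vec κ) (i : ι) :
    matVec A v i = ∑ j, A i j * v j := rfl

theorem matVec_sub (A : Matrix ι κ ℝ) (v w : Vec κ) :
    matVec A (v - w) = matVec A v - matVec A w := by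
  ext i; simp [mul_sub, Finset.sum_sub_distrib]

theorem sub_matVec (A B : Matrix ι κ ℝ) (v : Vec κ) :
    matVec (A - B) v = matVec A v - matVec B v := by
  ext i; simp [sub_mul, Finset.sum_sub_distrib]

theorem matVec_mul {ν : Type} [Fintype ν] (A : Matrix ι κ ℝ) (B : Matrix κ ν ℝ) (v : Vec ν) :
    matVec (A * B) v = matVec A (matVec B v) := by
  simp [matVec, Matrix.mulVec_mulVec]

theorem abs_coord_le_norm (v : Vec ι) (i : ι) : |v i| ≤ ‖v‖ := by
  simpa using PiLp.norm_apply_le v i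

theorem norm_le_sum_abs (v : Vec ι) : ‖v‖ ≤ ∑ i, |v i| := by
  rw [EuclideanSpace.norm_eq]
  refine Real.sqrt_le_iff.2 ⟨Finset.sum_nonneg fun i _ => abs_nonneg _, ?_⟩
  simpa using Finset.sum_sq_le_sq_sum_of_nonneg (s := Finset.univ) (f := fun i => |v i|)
    (fun i _ => abs_nonneg _)

theorem norm_matVec_le {A : Matrix ι κ ℝ} {C : ℝ} (hA : ∀ i j, |A i j| ≤ C) (v : Vec κ) :
    ‖matVec A v‖ ≤ Fintype.card ι * Fintype.card κ * C * ‖v‖ := by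
  refine (norm_le_sum_abs _).trans ?_
  calc ∑ i, |matVec A v i| ≤ ∑ _i : ι, ∑ _j : κ, C * ‖v‖ := by
        refine Finset.sum_le_sum fun i _ => (Finset.abs_sum_le_sum_abs _ _).trans ?_
        refine Finset.sum_le_sum fun j _ => ?_
        rw [abs_mul]
        exact mul_le_mul (hA i j) (abs_coord_le_norm v j) (abs_nonneg _)
          ((abs_nonneg _).trans (hA i j))
    _ = _ := by simp; ring

theorem hasDerivWithinAt_vec {v : ℝ → Vec ι} {v' : Vec ι} {s : Set ℝ} {t : ℝ} :
    HasDerivWithinAt v v' s t ↔ ∀ i, HasDerivWithinAt (fun τ => v τ i) (v' i) s t := by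
  rw [hasDerivWithinAt_iff_hasFDerivWithinAt, hasFDerivWithinAt_piLp]
  refine forall_congr' fun i => ?_
  rw [hasDerivWithinAt_iff_hasFDerivWithinAt]
  exact iff_of_eq (by congr 1)

theorem HasDerivWithinAt.matVec {A : ℝ → Matrix ι κ ℝ} {A' : Matrix ι κ ℝ} {v : ℝ → Vec κ}
    {v' : Vec κ} {s : Set ℝ} {t : ℝ}
    (hA : ∀ i j, HasDerivWithinAt (fun τ => A τ i j) (A' i j) s t)
    (hv : HasDerivWithinAt v v' s t) :
    HasDerivWithinAt (fun τ => matVec (A τ) (v τ)) (matVec A' (v t) + matVec (A t) v') s t := by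
  rw [hasDerivWithinAt_vec] at hv ⊢
  intro i
  simp only [matVec_apply, PiLp.add_apply, ← Finset.sum_add_distrib]
  exact HasDerivWithinAt.fun_sum fun j _ => (hA i j).mul (hv j)

theorem HasDerivAt.matVec {A : ℝ → Matrix ι κ ℝ} {A' : Matrix ι κ ℝ} {v : ℝ → Vec κ}
    {v' : Vec κ} {t : ℝ} (hA : ∀ i j, HasDerivAt (fun τ => A τ i j) (A' i j) t)
    (hv : HasDerivAt v v' t) :
    HasDerivAt (fun τ => matVec (A τ) (v τ)) (matVec A' (v t) + matVec (A t) v') t := by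
  simp only [← hasDerivWithinAt_univ] at hA hv ⊢
  exact HasDerivWithinAt.matVec hA hv

theorem norm_sgnVec_le (v : Vec ι) : ‖sgnVec v‖ ≤ Fintype.card ι := by
  refine (norm_le_sum_abs _).trans ?_
  calc ∑ i, |sgnVec v i| ≤ ∑ _i : ι, (1 : ℝ) := by
        refine Finset.sum_le_sum fun i _ => ?_
        rcases Real.sign_apply_eq (v i) with h | h | h <;> simp [sgnVec, h]
    _ = _ := by simp

theorem AbsolutelyContinuousOnInterval.matVec_coord {A : ℝ → Matrix ι κ ℝ} {v : ℝ → Vec κ}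
    {a b : ℝ} (hA : ∀ i j, AbsolutelyContinuousOnInterval (fun t => A t i j) a b)
    (hv : ∀ j, AbsolutelyContinuousOnInterval (fun t => v t j) a b) (i : ι) :
    AbsolutelyContinuousOnInterval (fun t => _root_.matVec (A t) (v t) i) a b :=
  AbsolutelyContinuousOnInterval.fun_sum _ fun j _ => (hA i j).fun_mul (hv j)

end MatVec

/-! ### Bounds on the regressor and on the unprojected update `Λ₀`. -/

namespace AdaptiveSystem

variable {n m : ℕ} {S : AdaptiveSystem n m}

/-- The matrix `[A  I]`. -/
def augment (A : Matrix (Fin n) (Fin m) ℝ) : Matrix (Fin n) (Fin m ⊕ Fin n) ℝ :=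
  Matrix.fromCols A 1

/-- The domain `ℝⁿ × [0, ∞)` of the regressor. -/
abbrev spaceTime (n : ℕ) : Set (Vec (Fin n) × ℝ) := univ ×ˢ Ici 0

theorem uniqueDiffOn_spaceTime : UniqueDiffOn ℝ (spaceTime n) :=
  uniqueDiffOn_univ.prod (uniqueDiffOn_Ici 0)

theorem mk_mem_spaceTime (x : Vec (Fin n)) {t : ℝ} (ht : 0 ≤ t) : (x, t) ∈ spaceTime n :=
  ⟨mem_univ _, ht⟩

namespace Assumptions

theorem Y_contDiff (hS : S.Assumptions) (i j) :
    ContDiffOn ℝ 2 (fun p : Vec (Fin n) × ℝ => S.Y p.1 p.2 i j) (spaceTime n) := by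
  rcases j with j | j
  · exact hS.Yh_contDiff i j
  · exact contDiffOn_const

/-- A common bound for the regressor and its first two derivatives. -/
theorem exists_Y_bound (hS : S.Assumptions) (R : ℝ) : ∃ C : ℝ, 0 ≤ C ∧
    ∀ i j x t, ‖x‖ ≤ R → 0 ≤ t →
      |S.Y x t i j| ≤ C ∧
      ‖fderivWithin ℝ (fun p : Vec (Fin n) × ℝ => S.Y p.1 p.2 i j) (spaceTime n) (x, t)‖ ≤ C ∧
      ‖fderivWithin ℝ (fderivWithin ℝ (fun p : Vec (Fin n) × ℝ => S.Y p.1 p.2 i j)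
        (spaceTime n)) (spaceTime n) (x, t)‖ ≤ C := by
  obtain ⟨C, hC⟩ := hS.Yh_bounded R
  refine ⟨max C 1, le_max_of_le_right zero_le_one, fun i j x t hx ht => ?_⟩
  have hu := uniqueDiffOn_spaceTime (n := n) _ (mk_mem_spaceTime x ht)
  rcases j with j | j
  · have h0 := hC i j 0 (by norm_num) x t hx ht
    have h1 := hC i j 1 (by norm_num) x t hx ht
    have h2 := hC i j 2 le_rfl x t hx ht
    rw [norm_iteratedFDerivWithin_zero] at h0
    rw [norm_iteratedFDerivWithin_one _ hu] at h1
    rw [← norm_iteratedFDerivWithin_fderivWithin uniqueDiffOn_spaceTime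
      (mk_mem_spaceTime x ht), norm_iteratedFDerivWithin_one _ hu] at h2
    exact ⟨h0.trans (le_max_left _ _), h1.trans (le_max_left _ _), h2.trans (le_max_left _ _)⟩
  · have hY : (fun p : Vec (Fin n) × ℝ => S.Y p.1 p.2 i (Sum.inr j)) =
        fun _ => (1 : Matrix (Fin n) (Fin n) ℝ) i j := rfl
    have hY' : S.Y x t i (Sum.inr j) = (1 : Matrix (Fin n) (Fin n) ℝ) i j := rfl
    rw [hY, hY']
    have h1 : fderivWithin ℝ (fun _ : Vec (Fin n) × ℝ => (1 : Matrix (Fin n) (Fin n) ℝ) i j)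
        (spaceTime n) = fun _ => 0 := by
      ext1 p
      exact fderivWithin_const_apply _
    rw [h1]
    have h0 : (0 : ℝ) ≤ max C 1 := le_max_of_le_right zero_le_one
    refine ⟨le_max_of_le_right ?_, norm_zero.trans_le h0, ?_⟩
    · rw [Matrix.one_apply]
      split_ifs <;> simp
    · rw [fderivWithin_fun_const]
      exact (norm_zero (E := Vec (Fin n) × ℝ →L[ℝ] Vec (Fin n) × ℝ →L[ℝ] ℝ)).trans_le h0

theorem hasDerivWithinAt_θ (hS : S.Assumptions) {t : ℝ} (ht : 0 ≤ t) :
    HasDerivWithinAt S.θ (S.θ' t) (Ici 0) t :=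
  (hS.θ_diff t ht).hasDerivWithinAt

theorem hasDerivWithinAt_xd (hS : S.Assumptions) {t : ℝ} (ht : 0 ≤ t) :
    HasDerivWithinAt S.xd (S.xd' t) (Ici 0) t :=
  (hS.xd_diff t ht).hasDerivWithinAt

theorem hasDerivWithinAt_Y (hS : S.Assumptions) {x : ℝ → Vec (Fin n)} {v : Vec (Fin n)} {t : ℝ}
    (ht : 0 ≤ t) (hx : HasDerivWithinAt x v (Ici 0) t) (i j) :
    HasDerivWithinAt (fun s => S.Y (x s) s i j) (S.Ydot (x t) v t i j) (Ici 0) t := by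
  have h1 : HasFDerivWithinAt (fun p : Vec (Fin n) × ℝ => S.Y p.1 p.2 i j)
      (fderivWithin ℝ (fun p : Vec (Fin n) × ℝ => S.Y p.1 p.2 i j) (spaceTime n) (x t, t))
      (spaceTime n) (x t, t) :=
    ((hS.Y_contDiff i j).differentiableOn (by norm_num) _
      (mk_mem_spaceTime _ ht)).hasFDerivWithinAt
  exact HasFDerivWithinAt.comp_hasDerivWithinAt (f := fun s => (x s, s)) t h1
    (hx.prodMk (hasDerivWithinAt_id t _)) fun s hs => mk_mem_spaceTime _ hs

theorem hasDerivWithinAt_Yd (hS : S.Assumptions) {t : ℝ} (ht : 0 ≤ t) (i j) :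
    HasDerivWithinAt (fun s => S.Yd s i j) (S.Yddot t i j) (Ici 0) t :=
  hS.hasDerivWithinAt_Y ht (hS.hasDerivWithinAt_xd ht) i j

theorem exists_Yd_bound (hS : S.Assumptions) :
    ∃ C : ℝ, 0 ≤ C ∧ ∀ t, 0 ≤ t → ∀ i j, |S.Yd t i j| ≤ C ∧ |S.Yddot t i j| ≤ C ∧
      ∃ d, |d| ≤ C ∧ HasDerivWithinAt (fun s => S.Yddot s i j) d (Ici 0) t := by
  obtain ⟨R, hR⟩ := hS.xd_le
  obtain ⟨R₁, hR₁⟩ := hS.xd'_le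
  obtain ⟨R₂, hR₂⟩ := hS.xd''_le
  obtain ⟨C, hC0, hC⟩ := hS.exists_Y_bound R
  have hR₁0 : 0 ≤ R₁ := (norm_nonneg _).trans (hR₁ 0 le_rfl)
  have hR₂0 : 0 ≤ R₂ := (norm_nonneg _).trans (hR₂ 0 le_rfl)
  refine ⟨C + C * (R₁ + 1) + (C * (R₁ + 1) * (R₁ + 1) + C * R₂), by positivity,
    fun t ht i j => ?_⟩
  obtain ⟨h0, h1, h2⟩ := hC i j (S.xd t) t (hR t ht) ht
  have hv : ‖((S.xd' t, 1) : Vec (Fin n) × ℝ)‖ ≤ R₁ + 1 := by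
    rw [Prod.norm_def]
    refine max_le ((hR₁ t ht).trans (by linarith)) ?_
    simp [hR₁0]
  have hv' : ‖((derivWithin S.xd' (Ici 0) t, 0) : Vec (Fin n) × ℝ)‖ ≤ R₂ := by
    rw [Prod.norm_def]
    exact max_le (hR₂ t ht) (by simpa using hR₂0)
  have hY1 : |S.Yddot t i j| ≤ C * (R₁ + 1) :=
    (ContinuousLinearMap.le_opNorm _ _).trans (mul_le_mul h1 hv (norm_nonneg _) hC0)
  have e1 : 0 ≤ C * (R₁ + 1) := by positivity
  have e2 : 0 ≤ C * (R₁ + 1) * (R₁ + 1) := by positivity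
  have e3 : 0 ≤ C * R₂ := by positivity
  have hY0 : |S.Yd t i j| ≤ C := h0
  refine ⟨by linarith, by linarith, ?_⟩
  -- The entry of Ẏ_d is the first derivative `F` along (x_d, t) applied to (x_d', 1). The product
  -- rule yields one term with the second derivative of Y and one with x_d''.
  set F := fderivWithin ℝ (fun p : Vec (Fin n) × ℝ => S.Y p.1 p.2 i j) (spaceTime n) with hF
  have hF1 : HasFDerivWithinAt F (fderivWithin ℝ F (spaceTime n) (S.xd t, t))
      (spaceTime n) (S.xd t, t) :=
    (((hS.Y_contDiff i j).fderivWithin uniqueDiffOn_spaceTime (m := 1)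
      (by norm_num)).differentiableOn (by norm_num) _
      (mk_mem_spaceTime _ ht)).hasFDerivWithinAt
  have hF2 := HasFDerivWithinAt.comp_hasDerivWithinAt (f := fun s => (S.xd s, s)) t hF1
    ((hS.hasDerivWithinAt_xd ht).prodMk (hasDerivWithinAt_id t _))
    fun s hs => mk_mem_spaceTime _ hs
  refine ⟨_, ?_, hF2.clm_apply ((hS.xd'_diff t ht).hasDerivWithinAt.prodMk
    (hasDerivWithinAt_const t (Ici 0) (1 : ℝ)))⟩
  refine (abs_add_le _ _).trans ?_
  have a1 := (ContinuousLinearMap.le_opNorm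
    (fderivWithin ℝ F (spaceTime n) (S.xd t, t) (S.xd' t, 1)) (S.xd' t, 1)).trans
    (mul_le_mul ((ContinuousLinearMap.le_opNorm _ _).trans
      (mul_le_mul h2 hv (norm_nonneg _) hC0)) hv (norm_nonneg _) e1)
  have a2 := (ContinuousLinearMap.le_opNorm (F (S.xd t, t))
    (derivWithin S.xd' (Ici 0) t, 0)).trans (mul_le_mul h1 hv' (norm_nonneg _) hC0)
  refine (add_le_add a1 a2).trans ?_
  linarith

/-- The identity block makes the matrix A Γ₁ Aᵀ + Γ₂, positive semidefinite plus positive definite,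
so no rank condition on Y_h is needed. -/
theorem isUnit_det_augment (hS : S.Assumptions) (A : Matrix (Fin n) (Fin m) ℝ) :
    IsUnit (augment A * S.Γ * (augment A)ᵀ).det := by
  have : (augment A * S.Γ * (augment A)ᵀ) =
      A * S.Γ₁ * Aᵀ + S.Γ₂ := by
    simp [augment, Γ, Matrix.fromCols_mul_fromBlocks, Matrix.transpose_fromCols,
      Matrix.fromCols_mul_fromRows]
  rw [this]
  have h1 := hS.Γ₁_posDef.posSemidef.mul_mul_conjTranspose_same A
  rw [Matrix.conjTranspose_eq_transpose_of_trivial] at h1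
  exact (Matrix.PosDef.posSemidef_add h1 hS.Γ₂_posDef).det_pos.ne'.isUnit

theorem Yd_mul_Λ₀ (hS : S.Assumptions) (G : Gains) (t : ℝ) (x : Vec (Fin n)) :
    matVec (S.Yd t) (S.Λ₀ G t x) = G.β • sgnVec (S.e t x) := by
  rw [Λ₀, ← matVec_mul]
  have : S.Yd t * (S.Γ * (S.Yd t)ᵀ * (S.Yd t * S.Γ * (S.Yd t)ᵀ)⁻¹) = 1 := by
    rw [← Matrix.mul_assoc, ← Matrix.mul_assoc]
    exact Matrix.mul_nonsing_inv _ (hS.isUnit_det_augment _)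
  rw [this]
  ext i
  simp [Matrix.one_apply]

/-- The weighted pseudoinverse depends continuously on the block Y_h, by nonvanishing of the
determinant, and the entries of that block stay in a compact box. The bound is linear in β and
uniform in time. -/
theorem exists_Λ₀_bound (hS : S.Assumptions) :
    ∃ B : ℝ, 0 ≤ B ∧ ∀ (G : Gains) t x, 0 ≤ t → 0 ≤ G.β → ‖S.Λ₀ G t x‖ ≤ B * G.β := by
  obtain ⟨C, hC0, hC⟩ := hS.exists_Yd_bound
  let Q : Matrix (Fin n) (Fin m) ℝ → Matrix (Fin m ⊕ Fin n) (Fin n) ℝ := fun A =>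
    S.Γ * (augment A)ᵀ * (augment A * S.Γ * (augment A)ᵀ)⁻¹
  have hcol : Continuous fun A : Matrix (Fin n) (Fin m) ℝ =>
      augment A := by
    refine continuous_matrix fun i j => ?_
    rcases j with j | j
    · exact continuous_id.matrix_elem i j
    · exact continuous_const
  have hW : Continuous fun A : Matrix (Fin n) (Fin m) ℝ =>
      augment A * S.Γ * (augment A)ᵀ :=
    (hcol.matrix_mul continuous_const).matrix_mul hcol.matrix_transpose
  have hQ : Continuous Q := by
    refine (continuous_const.matrix_mul hcol.matrix_transpose).matrix_mul ?_
    simp only [Matrix.inv_def, Ring.inverse_eq_inv']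
    exact (hW.matrix_det.inv₀ fun A => (hS.isUnit_det_augment A).ne_zero).smul hW.matrix_adjugate
  have hcomp : IsCompact (univ.pi fun _ : Fin n => univ.pi fun _ : Fin m => Icc (-C) C) :=
    isCompact_univ_pi fun _ => isCompact_univ_pi fun _ => isCompact_Icc
  have hb : ∀ i j, ∃ D, ∀ A ∈ (univ.pi fun _ : Fin n => univ.pi fun _ : Fin m => Icc (-C) C),
      ‖Q A i j‖ ≤ D := fun i j =>
    hcomp.exists_bound_of_continuousOn (hQ.matrix_elem i j).continuousOn
  choose D hD using hb
  let D' := ∑ i, ∑ j, |D i j|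
  refine ⟨Fintype.card (Fin m ⊕ Fin n) * Fintype.card (Fin n) * D' * Fintype.card (Fin n),
    by positivity, fun G t x ht hβ => ?_⟩
  have hA : ∀ i j, |(Q (S.Yh (S.xd t) t)) i j| ≤ D' := by
    intro i j
    have h1 := hD i j (S.Yh (S.xd t) t) fun k _ l _ => abs_le.1 (hC t ht k (Sum.inl l)).1
    refine (h1.trans (le_abs_self _)).trans ?_
    refine le_trans ?_ (Finset.single_le_sum (f := fun i => ∑ j, |D i j|)
      (fun i _ => by positivity) (Finset.mem_univ i))
    exact Finset.single_le_sum (f := fun j => |D i j|) (fun i _ => by positivity)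
      (Finset.mem_univ j)
  refine (norm_matVec_le hA _).trans ?_
  rw [norm_smul, Real.norm_of_nonneg hβ, mul_assoc _ (Fintype.card (Fin n) : ℝ) G.β,
    mul_comm _ G.β]
  gcongr
  exact norm_sgnVec_le _

theorem exists_Y_lipschitz (hS : S.Assumptions) (R b : ℝ) (i j) : ∃ C : NNReal,
    LipschitzOnWith C (fun p : Vec (Fin n) × ℝ => S.Y p.1 p.2 i j)
      (Metric.closedBall 0 R ×ˢ Icc 0 b) :=
  ((hS.Y_contDiff i j).mono (prod_mono (subset_univ _) Icc_subset_Ici_self)).exists_lipschitzOnWith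
    (by norm_num) ((convex_closedBall _ _).prod (convex_Icc _ _))
    ((isCompact_closedBall _ _).prod isCompact_Icc)

end Assumptions

end AdaptiveSystem

/-! ### The differential inclusion of the closed loop. -/

theorem continuous_vec {X ι : Type} [TopologicalSpace X] [Fintype ι] {φ : X → Vec ι}
    (h : ∀ i, Continuous fun w => φ w i) : Continuous φ :=
  (PiLp.continuous_toLp 2 _).comp (continuous_pi h)

theorem vec_eq_of_mem_filippovMap {E ι : Type} [NormedAddCommGroup E] [NormedSpace ℝ E]
    [MeasureSpace E] [Fintype ι] {g : ℝ → E → E} {t : ℝ} {w v : E} {φ : E → Vec ι}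
    (l : E →L[ℝ] Vec ι) (hv : v ∈ filippovMap g t w) (hφ : Continuous φ)
    (h : ∀ w', l (g t w') = φ w') : l v = φ w := by
  ext i
  refine eq_of_mem_filippovMap (φ := fun w => φ w i) ((EuclideanSpace.proj (𝕜 := ℝ) i).comp l) hv
    ?_ (Eventually.of_forall fun w' => ?_)
  · exact ((EuclideanSpace.proj (𝕜 := ℝ) i).continuous.comp hφ).continuousAt
  · simp [h]

theorem HasDerivAt.of_prodMk {A B : Type*} [NormedAddCommGroup A] [NormedSpace ℝ A]
    [NormedAddCommGroup B] [NormedSpace ℝ B] {f : ℝ → A} {g : ℝ → B} {v : A × B} {t : ℝ}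
    (h : HasDerivAt (fun τ => (f τ, g τ)) v t) : HasDerivAt f v.1 t ∧ HasDerivAt g v.2 t :=
  ⟨(ContinuousLinearMap.fst ℝ A B).hasFDerivAt.comp_hasDerivAt (f := fun τ => (f τ, g τ)) t h,
    (ContinuousLinearMap.snd ℝ A B).hasFDerivAt.comp_hasDerivAt (f := fun τ => (f τ, g τ)) t h⟩

namespace AdaptiveSystem

/-- The state space of the closed loop. -/
abbrev State (n m : ℕ) := Vec (Fin n) × Vec (Fin m ⊕ Fin n) × Vec (Fin n)

variable {n m : ℕ} {S : AdaptiveSystem n m}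

theorem r_eq (S : AdaptiveSystem n m) (G : Gains) (t : ℝ) (x : Vec (Fin n))
    (θhat : Vec (Fin m ⊕ Fin n)) (μ : Vec (Fin n)) :
    S.r G t x θhat μ = matVec (S.Y x t) (S.θ t) - matVec (S.Yd t) θhat + μ := by
  simp only [r, xdot, u]; abel

theorem xdot_eq (S : AdaptiveSystem n m) (G : Gains) (t : ℝ) (x : Vec (Fin n))
    (θhat : Vec (Fin m ⊕ Fin n)) (μ : Vec (Fin n)) :
    S.xdot G t x θhat μ = S.xd' t + S.r G t x θhat μ - G.α • S.e t x := by
  simp only [r]; abel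

theorem inner_gradient_Λ₁ (S : AdaptiveSystem n m) (G : Gains) (t : ℝ) (x : Vec (Fin n))
    (θhat : Vec (Fin m ⊕ Fin n)) : inner ℝ (gradient S.f θhat) (S.Λ₁ G t x θhat) = 0 := by
  rw [Λ₁, inner_sub_right, inner_smul_right, real_inner_self_eq_norm_sq]
  by_cases h : gradient S.f θhat = 0
  · simp [h]
  · have : ‖gradient S.f θhat‖ ^ 2 ≠ 0 := by simpa using h
    field_simp
    ring

/-- Pythagoras: `Λ₁` is `Λ₀` minus its component along the gradient. -/
theorem norm_Λ₁_le (S : AdaptiveSystem n m) (G : Gains) (t : ℝ) (x : Vec (Fin n))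
    (θhat : Vec (Fin m ⊕ Fin n)) : ‖S.Λ₁ G t x θhat‖ ≤ ‖S.Λ₀ G t x‖ := by
  set g := gradient S.f θhat with hg
  set c := inner ℝ g (S.Λ₀ G t x) / ‖g‖ ^ 2 with hc
  have h1 : S.Λ₀ G t x = S.Λ₁ G t x θhat + c • g := by
    simp [Λ₁, hc, hg]
  have h2 : inner ℝ (S.Λ₁ G t x θhat) (c • g) = 0 := by
    rw [inner_smul_right, real_inner_comm, inner_gradient_Λ₁, mul_zero]
  have h3 := norm_add_sq_eq_norm_sq_add_norm_sq_of_inner_eq_zero _ _ h2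
  rw [← h1] at h3
  nlinarith [norm_nonneg (S.Λ₀ G t x), norm_nonneg (S.Λ₁ G t x θhat), norm_nonneg (c • g)]

theorem norm_θhatdot_le (S : AdaptiveSystem n m) (G : Gains) (t : ℝ) (x : Vec (Fin n))
    (θhat : Vec (Fin m ⊕ Fin n)) : ‖S.θhatdot G t x θhat‖ ≤ ‖S.Λ₀ G t x‖ := by
  rw [θhatdot]
  split_ifs
  · exact le_rfl
  · exact S.norm_Λ₁_le G t x θhat

/-- Outside the open ball the unprojected branch can only be taken through its sign condition, and
the projected velocity is orthogonal to the gradient. -/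
theorem inner_gradient_θhatdot_le (S : AdaptiveSystem n m) (G : Gains) (t : ℝ) (x : Vec (Fin n))
    {θhat : Vec (Fin m ⊕ Fin n)} (h : S.θbar ≤ ‖θhat‖) :
    inner ℝ (gradient S.f θhat) (S.θhatdot G t x θhat) ≤ 0 := by
  rw [θhatdot]
  split_ifs with hU
  · exact hU.resolve_left h.not_gt
  · exact (S.inner_gradient_Λ₁ G t x θhat).le

namespace Assumptions

/-- The correction -Y_d(Λ₀ - Λ₁) in the law for μ is designed for this identity: the projection
drops out of the error dynamics. -/
theorem Yd_θhatdot_sub_μdot (hS : S.Assumptions) (G : Gains) (t : ℝ) (x : Vec (Fin n))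
    (θhat : Vec (Fin m ⊕ Fin n)) (μ : Vec (Fin n)) :
    matVec (S.Yd t) (S.θhatdot G t x θhat) - S.μdot G t x θhat μ =
      G.K • S.r G t x θhat μ + G.β • sgnVec (S.e t x) := by
  rw [← hS.Yd_mul_Λ₀, θhatdot, μdot]
  split_ifs
  · abel
  · rw [matVec_sub]; abel

theorem continuous_r (hS : S.Assumptions) (G : Gains) {t : ℝ} (ht : 0 ≤ t) :
    Continuous fun w : State n m =>
      S.r G t w.1 w.2.1 w.2.2 := by
  have hY : ∀ i j, Continuous fun x : Vec (Fin n) => S.Y x t i j := fun i j =>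
    (hS.Y_contDiff i j).continuousOn.comp_continuous (by fun_prop : Continuous fun x => (x, t))
      fun x => mk_mem_spaceTime x ht
  simp only [r_eq]
  refine continuous_vec fun i => ?_
  simp only [PiLp.add_apply, PiLp.sub_apply, matVec_apply]
  refine Continuous.add (Continuous.sub ?_ ?_) (by fun_prop)
  · exact continuous_finsetSum _ fun j _ => ((hY i j).comp continuous_fst).mul continuous_const
  · fun_prop

theorem gradient_continuous (hS : S.Assumptions) : Continuous (gradient S.f) :=
  (InnerProductSpace.toDual ℝ _).symm.continuous.comp (hS.f_contDiff.continuous_fderiv one_ne_zero)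

theorem hasGradientAt (hS : S.Assumptions) (φ : Vec (Fin m ⊕ Fin n)) :
    HasGradientAt S.f (gradient S.f φ) φ :=
  (hS.f_contDiff.differentiable one_ne_zero φ).hasGradientAt

/-- The differential inclusion satisfied by the velocity of a closed-loop trajectory. -/
theorem mem_filippovMap_closedLoop (hS : S.Assumptions) {G : Gains} (hβ : 0 < G.β) {B : ℝ}
    (hB : ∀ (G : Gains) t x, 0 ≤ t → 0 ≤ G.β → ‖S.Λ₀ G t x‖ ≤ B * G.β) {t : ℝ} (ht : 0 ≤ t)
    {w v : State n m}
    (hv : v ∈ filippovMap (S.closedLoop G) t w) :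
    v.1 = S.xdot G t w.1 w.2.1 w.2.2 ∧ ‖v.2.1‖ ≤ B * G.β ∧
    (S.θbar < ‖w.2.1‖ → inner ℝ (gradient S.f w.2.1) v.2.1 ≤ 0) ∧
    ∃ ξ : Vec (Fin n),
      (∀ i, |ξ i| ≤ 1 ∧ (S.e t w.1 i ≠ 0 → ξ i = Real.sign (S.e t w.1 i))) ∧
      matVec (S.Yd t) v.2.1 - v.2.2 = G.K • S.r G t w.1 w.2.1 w.2.2 + G.β • ξ := by
  obtain ⟨pθ, hpθ⟩ : ∃ p : State n m →L[ℝ] Vec (Fin m ⊕ Fin n), ∀ z, p z = z.2.1 :=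
    ⟨(ContinuousLinearMap.fst ℝ _ _).comp (ContinuousLinearMap.snd ℝ _ _), fun _ => rfl⟩
  obtain ⟨pμ, hpμ⟩ : ∃ p : State n m →L[ℝ] Vec (Fin n), ∀ z, p z = z.2.2 :=
    ⟨(ContinuousLinearMap.snd ℝ _ _).comp (ContinuousLinearMap.snd ℝ _ _), fun _ => rfl⟩
  have hb : ∀ w' : State n m, ‖S.θhatdot G t w'.1 w'.2.1‖ ≤ B * G.β := fun w' =>
    (S.norm_θhatdot_le G t _ _).trans (hB G t _ ht hβ.le)
  refine ⟨?_, ?_, ?_, ?_⟩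
  · refine vec_eq_of_mem_filippovMap (φ := fun w : State n m => S.xdot G t w.1 w.2.1 w.2.2)
      (ContinuousLinearMap.fst ℝ _ _) hv ?_ fun w' => rfl
    simp only [xdot_eq, e]
    have := hS.continuous_r G ht
    fun_prop
  · have := mem_of_mem_filippovMap (s := pθ ⁻¹' Metric.closedBall 0 (B * G.β)) hv
      (Metric.isClosed_closedBall.preimage pθ.continuous)
      ((convex_closedBall _ _).linear_preimage pθ.toLinearMap)
      (Eventually.of_forall fun w' => by simpa [hpθ, closedLoop] using hb w')
    simpa [hpθ] using this
  · intro hw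
    rw [← hpθ v]
    refine le_of_mem_filippovMap ((innerSL ℝ (gradient S.f w.2.1)).comp pθ) hv fun ε hε => ?_
    have hBβ : 0 ≤ B * G.β := (norm_nonneg _).trans (hb w)
    -- The sign condition is known at nearby states with their own gradient, whereas the functional
    -- must be fixed. Continuity of the gradient bridges the gap. The `+ 1` in the tolerance avoids
    -- division by zero.
    have h1 : ∀ᶠ w' : State n m in 𝓝 w, S.θbar < ‖w'.2.1‖ :=
      continuousAt_const.eventually_lt (by fun_prop) hw
    have hg : Continuous fun w' : State n m => ‖gradient S.f w.2.1 - gradient S.f w'.2.1‖ :=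
      (continuous_const.sub (hS.gradient_continuous.comp
        (continuous_fst.comp continuous_snd))).norm
    have h2 : ∀ᶠ w' : State n m in 𝓝 w, ‖gradient S.f w.2.1 - gradient S.f w'.2.1‖ < ε / (B * G.β + 1) :=
      hg.continuousAt.eventually_lt continuousAt_const (by simp; positivity)
    filter_upwards [h1, h2] with w' h1 h2
    have h3 := S.inner_gradient_θhatdot_le G t w'.1 h1.le
    have h4 := (real_inner_le_norm (gradient S.f w.2.1 - gradient S.f w'.2.1)
      (S.θhatdot G t w'.1 w'.2.1)).trans (mul_le_mul h2.le (hb w') (norm_nonneg _) (by positivity))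
    have h5 : ε / (B * G.β + 1) * (B * G.β) ≤ ε := by
      rw [div_mul_eq_mul_div, div_le_iff₀ (by positivity)]
      nlinarith
    rw [inner_sub_left] at h4
    rw [ContinuousLinearMap.comp_apply, innerSL_apply_apply, hpθ, closedLoop]
    linarith
  · obtain ⟨lc, hlc⟩ : ∃ l : Fin n → State n m →L[ℝ] ℝ,
        ∀ i z, l i z = (matVec (S.Yd t) z.2.1 - z.2.2) i :=
      ⟨fun i => (∑ j, S.Yd t i j • (EuclideanSpace.proj (𝕜 := ℝ) j).comp pθ) -
        (EuclideanSpace.proj (𝕜 := ℝ) i).comp pμ, fun i z => by simp [hpθ, hpμ]⟩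
    have hfield : ∀ i (w' : State n m), lc i (S.closedLoop G t w') =
        G.K * S.r G t w'.1 w'.2.1 w'.2.2 i + G.β * Real.sign (S.e t w'.1 i) := by
      intro i w'
      rw [hlc]
      exact congrArg (fun z : Vec (Fin n) => z i) (hS.Yd_θhatdot_sub_μdot G t w'.1 w'.2.1 w'.2.2)
    have hrc : ∀ i, Continuous fun w' : State n m => G.K * S.r G t w'.1 w'.2.1 w'.2.2 i := fun i =>
      continuous_const.mul ((EuclideanSpace.proj (𝕜 := ℝ) i).continuous.comp (hS.continuous_r G ht))
    -- The selection ξ is defined by solving the required identity for it. Its properties follow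
    -- since the functionals `lc i` of the field are continuous up to the signum term.
    refine ⟨WithLp.toLp 2 fun i => (lc i v - G.K * S.r G t w.1 w.2.1 w.2.2 i) / G.β,
      fun i => ⟨?_, fun hi => ?_⟩, ?_⟩
    · have hs : ∀ a : ℝ, |Real.sign a| ≤ 1 := fun a => by
        rcases Real.sign_apply_eq a with h | h | h <;> simp [h]
      have hu : lc i v ≤ G.K * S.r G t w.1 w.2.1 w.2.2 i + G.β := by
        refine le_of_mem_filippovMap (lc i) hv fun ε hε => ?_
        filter_upwards [(hrc i).continuousAt.eventually_lt continuousAt_const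
          (lt_add_of_pos_right _ hε)] with w' h1
        have := (abs_le.1 (hs (S.e t w'.1 i))).2
        rw [hfield]
        nlinarith
      have hl : -lc i v ≤ -(G.K * S.r G t w.1 w.2.1 w.2.2 i) + G.β := by
        refine le_of_mem_filippovMap (-lc i) hv fun ε hε => ?_
        filter_upwards [continuousAt_const.eventually_lt (hrc i).continuousAt
          (sub_lt_self _ hε)] with w' h1
        have := (abs_le.1 (hs (S.e t w'.1 i))).1
        rw [_root_.neg_apply, hfield]
        nlinarith
      change |(lc i v - G.K * S.r G t w.1 w.2.1 w.2.2 i) / G.β| ≤ 1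
      rw [abs_div, abs_of_pos hβ, div_le_one hβ, abs_le]
      constructor <;> linarith
    · have hec : Continuous fun w' : State n m => S.e t w'.1 i := by
        simp only [e, PiLp.sub_apply]
        fun_prop
      -- Where e_i ≠ 0 the signum is locally constant, so `lc i` of the field is continuous there
      -- and its value is determined.
      have hsign : ∀ᶠ w' : State n m in 𝓝 w, Real.sign (S.e t w'.1 i) = Real.sign (S.e t w.1 i) := by
        rcases lt_or_gt_of_ne hi with h | h
        · filter_upwards [hec.continuousAt.eventually_lt continuousAt_const h] with w' h'
          rw [Real.sign_of_neg h, Real.sign_of_neg h']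
        · filter_upwards [continuousAt_const.eventually_lt hec.continuousAt h] with w' h'
          rw [Real.sign_of_pos h, Real.sign_of_pos h']
      have := eq_of_mem_filippovMap (lc i) hv
        (φ := fun w' => G.K * S.r G t w'.1 w'.2.1 w'.2.2 i + G.β * Real.sign (S.e t w.1 i))
        ((hrc i).add (continuous_const (y := G.β * Real.sign (S.e t w.1 i)))).continuousAt
        (by filter_upwards [hsign] with w' h'; rw [hfield, h'])
      change (lc i v - G.K * S.r G t w.1 w.2.1 w.2.2 i) / G.β = _
      rw [this]
      field_simp
      ring
    · ext i
      rw [← hlc]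
      simp only [PiLp.add_apply, PiLp.smul_apply, smul_eq_mul]
      field_simp
      ring

end Assumptions

/-- The properties of a closed-loop trajectory at a regular time. -/
structure VelocityAt (S : AdaptiveSystem n m) (G : Gains) (B : ℝ) (x : ℝ → Vec (Fin n))
    (θhat : ℝ → Vec (Fin m ⊕ Fin n)) (μ : ℝ → Vec (Fin n)) (t : ℝ)
    (vθ : Vec (Fin m ⊕ Fin n)) (vμ ξ : Vec (Fin n)) : Prop where
  pos : 0 < t
  hasDerivAt_x : HasDerivAt x (S.xdot G t (x t) (θhat t) (μ t)) t
  hasDerivAt_θhat : HasDerivAt θhat vθ t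
  hasDerivAt_μ : HasDerivAt μ vμ t
  norm_le : ‖vθ‖ ≤ B * G.β
  inner_le : S.θbar < ‖θhat t‖ → inner ℝ (gradient S.f (θhat t)) vθ ≤ 0
  abs_le : ∀ i, |ξ i| ≤ 1
  eq_sign : ∀ i, S.e t (x t) i ≠ 0 → ξ i = Real.sign (S.e t (x t) i)
  Yd_sub : matVec (S.Yd t) vθ - vμ = G.K • S.r G t (x t) (θhat t) (μ t) + G.β • ξ

theorem IsTrajectory.ae_velocityAt (hS : S.Assumptions) {G : Gains} (hβ : 0 < G.β) {B : ℝ}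
    (hB : ∀ (G : Gains) t x, 0 ≤ t → 0 ≤ G.β → ‖S.Λ₀ G t x‖ ≤ B * G.β) {T : EReal}
    {x : ℝ → Vec (Fin n)} {θhat : ℝ → Vec (Fin m ⊕ Fin n)} {μ : ℝ → Vec (Fin n)}
    (h : S.IsTrajectory G T x θhat μ) :
    ∀ᵐ t : ℝ, t ∈ timeInterval T → ∃ vθ vμ ξ, S.VelocityAt G B x θhat μ t vθ vμ ξ := by
  -- Time 0 is discarded because the data are differentiable there only from the right.
  have h0 : ∀ᵐ t : ℝ, t ≠ 0 := by simp [ae_iff, measure_singleton]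
  filter_upwards [h0, h.solution.2] with t h0 ht htT
  obtain ⟨v, hv, hd⟩ := ht htT
  obtain ⟨h1, h2, h3, ξ, hξ, h4⟩ := hS.mem_filippovMap_closedLoop hβ hB htT.1 hv
  obtain ⟨hx, hd⟩ := hd.of_prodMk
  obtain ⟨hθ, hμ⟩ := hd.of_prodMk
  exact ⟨v.2.1, v.2.2, ξ, lt_of_le_of_ne htT.1 h0.symm, h1 ▸ hx, hθ, hμ, h2, h3,
    fun i => (hξ i).1, fun i => (hξ i).2, h4⟩

end AdaptiveSystem

/-! ### Invariance of the projection ball and bounds on N_B. -/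

theorem mem_timeInterval_of_le {T : EReal} {b t : ℝ} (hb : b ∈ timeInterval T) (h0 : 0 ≤ t)
    (htb : t ≤ b) : t ∈ timeInterval T :=
  ⟨h0, (EReal.coe_le_coe_iff.2 htb).trans_lt hb.2⟩

theorem AbsolutelyContinuousOnInterval.of_prodMk {A B : Type*} [NormedAddCommGroup A]
    [NormedAddCommGroup B] {f : ℝ → A} {g : ℝ → B} {a b : ℝ}
    (h : AbsolutelyContinuousOnInterval (fun t => (f t, g t)) a b) :
    AbsolutelyContinuousOnInterval f a b ∧ AbsolutelyContinuousOnInterval g a b := by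
  have hd : ∀ s t, dist (f s, g s) (f t, g t) = max (dist (f s) (f t)) (dist (g s) (g t)) :=
    fun s t => Prod.dist_eq
  constructor
  · refine squeeze_zero (fun E => Finset.sum_nonneg fun i _ => dist_nonneg)
      (fun E => Finset.sum_le_sum fun i _ => ?_) h
    exact (le_max_left _ _).trans_eq (hd _ _).symm
  · refine squeeze_zero (fun E => Finset.sum_nonneg fun i _ => dist_nonneg)
      (fun E => Finset.sum_le_sum fun i _ => ?_) h
    exact (le_max_right _ _).trans_eq (hd _ _).symm

theorem AbsolutelyContinuousOnInterval.of_norm_derivWithin_le {F : Type*} [NormedAddCommGroup F]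
    [NormedSpace ℝ F] {f : ℝ → F} {C b : ℝ} (hb : 0 ≤ b)
    (h : ∀ t, 0 ≤ t → ∃ d, ‖d‖ ≤ C ∧ HasDerivWithinAt f d (Ici 0) t) :
    AbsolutelyContinuousOnInterval f 0 b := by
  choose! d hd hf using h
  have hl : LipschitzOnWith (Real.toNNReal C) f (Ici 0) :=
    (convex_Ici 0).lipschitzOnWith_of_nnnorm_hasDerivWithin_le (fun t ht => hf t ht)
      fun t ht => by
        rw [← NNReal.coe_le_coe, coe_nnnorm]
        exact (hd t ht).trans (Real.le_coe_toNNReal C)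
  refine (hl.mono ?_).absolutelyContinuousOnInterval
  rw [uIcc_of_le hb]
  exact Icc_subset_Ici_self

namespace AdaptiveSystem

variable {n m : ℕ} {S : AdaptiveSystem n m}

namespace Assumptions

theorem f_nonpos (hS : S.Assumptions) {φ : Vec (Fin m ⊕ Fin n)} (h : ‖φ‖ ≤ S.θbar) :
    S.f φ ≤ 0 := by
  rcases h.lt_or_eq with h | h
  · exact (hS.f_neg φ h).le
  · exact (hS.f_zero φ h).le

/-- The segment from 0 to φ meets the sphere, where f = 0. As f(0) < 0, convexity forces f(φ) > 0.
Thus {f ≤ 0} is exactly the closed ball. -/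
theorem f_pos (hS : S.Assumptions) {φ : Vec (Fin m ⊕ Fin n)} (h : S.θbar < ‖φ‖) :
    0 < S.f φ := by
  have hφ : 0 < ‖φ‖ := hS.θbar_pos.trans h
  set s := S.θbar / ‖φ‖ with hs
  have hs0 : 0 < s := div_pos hS.θbar_pos hφ
  have hs1 : s < 1 := (div_lt_one hφ).2 h
  have h0 : S.f 0 < 0 := hS.f_neg 0 (by simpa using hS.θbar_pos)
  have h1 : S.f (s • φ) = 0 := hS.f_zero _ (by
    rw [norm_smul, Real.norm_of_nonneg hs0.le, hs, div_mul_cancel₀ _ hφ.ne'])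
  have h2 := hS.f_convex.2 (mem_univ 0) (mem_univ φ) (sub_nonneg.2 hs1.le) hs0.le
    (sub_add_cancel 1 s)
  rw [smul_zero, zero_add, h1] at h2
  simp only [smul_eq_mul] at h2
  by_contra hneg
  nlinarith [mul_pos (sub_pos.2 hs1) (neg_pos.2 h0), mul_nonneg hs0.le (neg_nonneg.2 (not_lt.1 hneg))]

end Assumptions

namespace IsTrajectory

variable {G : Gains} {T : EReal} {x : ℝ → Vec (Fin n)} {θhat : ℝ → Vec (Fin m ⊕ Fin n)}
  {μ : ℝ → Vec (Fin n)}

theorem ac (h : S.IsTrajectory G T x θhat μ) {b : ℝ} (hb : b ∈ timeInterval T) :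
    AbsolutelyContinuousOnInterval x 0 b ∧ AbsolutelyContinuousOnInterval θhat 0 b ∧
      AbsolutelyContinuousOnInterval μ 0 b :=
  have h1 := AbsolutelyContinuousOnInterval.of_prodMk (h.solution.1 b hb)
  ⟨h1.1, h1.2.of_prodMk⟩

/-- The projection keeps the parameter estimate in the ball. -/
theorem norm_θhat_le (h : S.IsTrajectory G T x θhat μ) (hS : S.Assumptions) (hβ : 0 < G.β)
    {t : ℝ} (ht : t ∈ timeInterval T) : ‖θhat t‖ ≤ S.θbar := by
  obtain ⟨B, -, hB⟩ := hS.exists_Λ₀_bound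
  by_contra! hgt
  have hpos := hS.f_pos hgt
  have hac := (h.ac ht).2.1
  obtain ⟨R, hR⟩ := hac.exists_bound
  obtain ⟨C, hC⟩ := (hS.f_contDiff.contDiffOn (s := Metric.closedBall 0 R)).exists_lipschitzOnWith
    one_ne_zero (convex_closedBall _ _) (isCompact_closedBall _ _)
  have hf : AbsolutelyContinuousOnInterval (fun s => S.f (θhat s)) 0 t :=
    hac.comp_lipschitzOnWith hC fun s hs => by simpa using hR s hs
  have hcont := hf.continuousOn
  rw [uIcc_of_le ht.1] at hcont
  have hcomp : IsCompact (Icc 0 t ∩ (fun s => S.f (θhat s)) ⁻¹' Iic 0) :=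
    isCompact_Icc.of_isClosed_subset
      (hcont.preimage_isClosed_of_isClosed isClosed_Icc isClosed_Iic) inter_subset_left
  -- `t₀` is the last time before `t` with f(θ̂) ≤ 0. Afterwards θ̂ is strictly outside the ball,
  -- where f(θ̂) cannot increase, which contradicts f(θ̂(t)) > 0.
  obtain ⟨t₀, ⟨ht₀, hft₀⟩, hmax⟩ := hcomp.exists_isGreatest
    ⟨0, left_mem_Icc.2 ht.1, hS.f_nonpos h.θhat_zero.le⟩
  have hdec : S.f (θhat t) - S.f (θhat t₀) ≤ 0 * (t - t₀) := by
    refine (hf.mono ?_).sub_le_of_ae_hasDerivAt_le ht₀.2 ?_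
    · rw [uIcc_of_le ht₀.2, uIcc_of_le ht.1]
      exact Icc_subset_Icc_left ht₀.1
    · filter_upwards [h.ae_velocityAt hS hβ hB] with s hs hst
      have hs0 : 0 ≤ s := ht₀.1.trans hst.1.le
      obtain ⟨vθ, vμ, ξ, hv⟩ := hs (mem_timeInterval_of_le ht hs0 hst.2.le)
      refine ⟨_, (hS.hasGradientAt (θhat s)).hasFDerivAt.comp_hasDerivAt s hv.hasDerivAt_θhat, ?_⟩
      rw [InnerProductSpace.toDual_apply_apply]
      refine hv.inner_le ?_
      by_contra! hle
      exact (hmax ⟨⟨hs0, hst.2.le⟩, hS.f_nonpos hle⟩).not_gt hst.1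
  have : S.f (θhat t₀) ≤ 0 := hft₀
  linarith

end IsTrajectory

theorem hasDerivAt_of_Ici {F : Type*} [NormedAddCommGroup F] [NormedSpace ℝ F] {φ : ℝ → F} {d : F}
    {t : ℝ} (ht : 0 < t) (h : HasDerivWithinAt φ d (Ici 0) t) : HasDerivAt φ d t :=
  h.hasDerivAt (Ici_mem_nhds ht)

/-- The constants bounding `N_B` and its derivative along trajectories. -/
theorem Assumptions.exists_NBBound (hS : S.Assumptions) :
    ∃ γ₁ : ℝ, 0 < γ₁ ∧ ∀ β : ℝ, 0 < β → ∃ γ₂ : ℝ, 0 < γ₂ ∧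
      ∀ α K : ℝ, 0 < α → 0 < K → ∀ T x θhat μ,
        S.IsTrajectory ⟨α, β, K⟩ T x θhat μ → S.NBBound γ₁ γ₂ T θhat := by
  obtain ⟨C, hC0, hC⟩ := hS.exists_Yd_bound
  obtain ⟨B, hB0, hB⟩ := hS.exists_Λ₀_bound
  obtain ⟨ζ₁, hζ₁⟩ := hS.θ'_le
  obtain ⟨ζ₂, hζ₂⟩ := hS.θ''_le
  have hζ₁0 : 0 ≤ ζ₁ := (norm_nonneg _).trans (hζ₁ 0 le_rfl)
  have hζ₂0 : 0 ≤ ζ₂ := (norm_nonneg _).trans (hζ₂ 0 le_rfl)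
  have hθ0 := hS.θbar_pos
  set c : ℝ := Fintype.card (Fin n) * Fintype.card (Fin m ⊕ Fin n) * C with hc
  have hc0 : 0 ≤ c := by positivity
  have hmv : ∀ {A : Matrix (Fin n) (Fin m ⊕ Fin n) ℝ}, (∀ i j, |A i j| ≤ C) →
      ∀ {v : Vec (Fin m ⊕ Fin n)} {a : ℝ}, ‖v‖ ≤ a → ‖matVec A v‖ ≤ c * a := fun hA _ _ hv =>
    (norm_matVec_le hA _).trans (mul_le_mul_of_nonneg_left hv hc0)
  -- The first constant does not involve β because θ̂ stays in the ball. The second does, through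
  -- the speed bound B β of θ̂. Each `+ 1` only ensures positivity.
  refine ⟨c * ζ₁ + c * S.θbar + c * S.θbar + 1, by positivity, fun β hβ =>
    ⟨(c * ζ₁ + c * ζ₂) + (c * S.θbar + c * ζ₁) + (c * S.θbar + c * (B * β)) + 1, by positivity,
      fun α K hα hK T x θhat μ h => ⟨fun t ht => ?_, ?_⟩⟩⟩
  · have h1 := hmv (fun i j => (hC t ht.1 i j).1) (hζ₁ t ht.1)
    have h2 := hmv (fun i j => (hC t ht.1 i j).2.1) (hS.θ_le t ht.1)
    have h3 := hmv (fun i j => (hC t ht.1 i j).2.1) (h.norm_θhat_le hS hβ ht)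
    refine (norm_sub_le_of_le (norm_add_le_of_le h1 h2) h3).trans ?_
    linarith
  · filter_upwards [h.ae_velocityAt hS hβ hB] with t hv ht
    obtain ⟨vθ, vμ, ξ, hv⟩ := hv ht
    have hY1 : ∀ i j, HasDerivAt (fun s => S.Yd s i j) (S.Yddot t i j) t := fun i j =>
      hasDerivAt_of_Ici hv.pos (hS.hasDerivWithinAt_Yd ht.1 i j)
    choose D hDC hD using fun i j => (hC t ht.1 i j).2.2
    have hY2 : ∀ i j, HasDerivAt (fun s => S.Yddot s i j) (Matrix.of D i j) t := fun i j =>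
      hasDerivAt_of_Ici hv.pos (hD i j)
    have hθ := hasDerivAt_of_Ici hv.pos (hS.hasDerivWithinAt_θ ht.1)
    have hθ' := hasDerivAt_of_Ici hv.pos (hS.θ'_diff t ht.1).hasDerivWithinAt
    have hNB : HasDerivAt (fun s => S.NB s (θhat s)) _ t :=
      ((HasDerivAt.matVec hY1 hθ').add (HasDerivAt.matVec hY2 hθ)).sub
        (HasDerivAt.matVec hY2 hv.hasDerivAt_θhat)
    refine ⟨hNB.differentiableAt, ?_⟩
    rw [hNB.deriv]
    have b1 : ∀ i j, |S.Yd t i j| ≤ C := fun i j => (hC t ht.1 i j).1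
    have b2 : ∀ i j, |S.Yddot t i j| ≤ C := fun i j => (hC t ht.1 i j).2.1
    have b3 : ∀ i j, |Matrix.of D i j| ≤ C := hDC
    refine (norm_sub_le_of_le (norm_add_le_of_le (norm_add_le_of_le (hmv b2 (hζ₁ t ht.1))
      (hmv b1 (hζ₂ t ht.1))) (norm_add_le_of_le (hmv b3 (hS.θ_le t ht.1))
      (hmv b2 (hζ₁ t ht.1)))) (norm_add_le_of_le (hmv b3 (h.norm_θhat_le hS hβ ht))
      (hmv b2 hv.norm_le))).trans ?_
    linarith

end AdaptiveSystem

/-! ### The growth bound for Ñ. -/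

/-- Every sequence has a positive, continuous, strictly increasing and unbounded majorant. -/
theorem exists_continuous_strictMono_majorant (c : ℕ → ℝ) (hc : ∀ k, 0 ≤ c k) :
    ∃ ρ : ℝ → ℝ, (∀ s, 0 ≤ s → 0 < ρ s) ∧ StrictMono ρ ∧ Continuous ρ ∧
      Tendsto ρ atTop atTop ∧ ∀ s, c ⌈s⌉₊ ≤ ρ s - s := by
  let C : ℝ → ℝ := fun s => ∑ k ∈ Finset.range (⌈s⌉₊ + 1), c k
  have hCm : Monotone C := fun s t hst => by
    refine Finset.sum_le_sum_of_subset_of_nonneg ?_ fun k _ _ => hc k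
    exact Finset.range_subset_range.2 (Nat.add_le_add_right (Nat.ceil_mono hst) 1)
  have hC0 : ∀ s, c ⌈s⌉₊ ≤ C s := fun s =>
    Finset.single_le_sum (f := c) (fun k _ => hc k) (Finset.mem_range.2 (Nat.lt_succ_self _))
  have hint : ∀ a b, IntervalIntegrable C volume a b := fun a b => hCm.intervalIntegrable
  -- Averaging the monotone step function `C` over [s, s + 1] makes it continuous, keeps it monotone
  -- and does not decrease it. Adding 1 + s gives positivity, strict growth and unboundedness.
  let I : ℝ → ℝ := fun s => ∫ u in s..(s + 1), C u
  have hI : ∀ s, I s = ∫ u in (0 : ℝ)..1, C (u + s) := fun s => by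
    rw [intervalIntegral.integral_comp_add_right]
    simp [I, add_comm]
  have hImono : Monotone I := fun s t hst => by
    rw [hI, hI]
    have hm : ∀ a : ℝ, Monotone fun u => C (u + a) := fun a u v huv =>
      hCm (add_le_add_left huv a)
    exact intervalIntegral.integral_mono zero_le_one (hm s).intervalIntegrable
      (hm t).intervalIntegrable fun u => hCm (add_le_add_right hst u)
  have hIC : ∀ s, C s ≤ I s := fun s => by
    have h1 : ∫ _ in s..(s + 1), C s = C s := by simp
    rw [← h1]
    exact intervalIntegral.integral_mono_on (by linarith) intervalIntegrable_const (hint _ _)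
      fun u hu => hCm hu.1
  have hIc : Continuous I := by
    have h1 := intervalIntegral.continuous_primitive hint 0
    have h2 : I = fun s => (∫ u in (0 : ℝ)..(s + 1), C u) - ∫ u in (0 : ℝ)..s, C u := by
      ext s
      rw [intervalIntegral.integral_interval_sub_left (hint _ _) (hint _ _)]
    rw [h2]
    exact (h1.comp (continuous_id.add continuous_const)).sub h1
  have hI0 : ∀ s, 0 ≤ I s := fun s => ((hc _).trans (hC0 s)).trans (hIC s)
  refine ⟨fun s => 1 + s + I s, fun s hs => ?_, fun s t hst => ?_, ?_, ?_, fun s => ?_⟩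
  · have := hI0 s
    positivity
  · have := hImono hst.le
    change 1 + s + I s < 1 + t + I t
    linarith
  · exact (continuous_const.add continuous_id).add hIc
  · exact tendsto_atTop_mono (fun s => by have := hI0 s; simp only [id]; linarith) tendsto_id
  · have := (hC0 s).trans (hIC s)
    linarith

namespace AdaptiveSystem

variable {n m : ℕ} {S : AdaptiveSystem n m}

theorem znorm_nonneg (e r : Vec (Fin n)) : 0 ≤ znorm e r := Real.sqrt_nonneg _

theorem znorm_sq (e r : Vec (Fin n)) : znorm e r ^ 2 = ‖r‖ ^ 2 + ‖e‖ ^ 2 :=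
  Real.sq_sqrt (by positivity)

theorem norm_e_le_znorm (e r : Vec (Fin n)) : ‖e‖ ≤ znorm e r :=
  Real.le_sqrt_of_sq_le (le_add_of_nonneg_left (sq_nonneg _))

theorem norm_r_le_znorm (e r : Vec (Fin n)) : ‖r‖ ≤ znorm e r :=
  Real.le_sqrt_of_sq_le (le_add_of_nonneg_right (sq_nonneg _))

namespace Assumptions

/-- Ñ vanishes at z = 0. The mean value inequality for Y and its first derivative on the convex set
ball × [0, ∞) makes it linear in ‖z‖, with a constant uniform in time. -/
theorem exists_Ntilde_bound (hS : S.Assumptions) {α : ℝ} (hα : 0 < α) (k : ℝ) (hk : 0 ≤ k) :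
    ∃ c : ℝ, 0 ≤ c ∧ ∀ t e r, 0 ≤ t → znorm e r ≤ k → ‖S.Ntilde α t e r‖ ≤ c * znorm e r := by
  obtain ⟨R, hR⟩ := hS.xd_le
  obtain ⟨R₁, hR₁⟩ := hS.xd'_le
  obtain ⟨ζ₁, hζ₁⟩ := hS.θ'_le
  obtain ⟨C, hC0, hC⟩ := hS.exists_Y_bound (R + k)
  have hR₁0 : 0 ≤ R₁ := (norm_nonneg _).trans (hR₁ 0 le_rfl)
  have hζ₁0 : 0 ≤ ζ₁ := (norm_nonneg _).trans (hζ₁ 0 le_rfl)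
  have hθ0 := hS.θbar_pos
  set N : ℝ := Fintype.card (Fin n) * Fintype.card (Fin m ⊕ Fin n) with hN
  have hN0 : 0 ≤ N := by positivity
  refine ⟨N * (C * (R₁ + 2 + α)) * S.θbar + N * C * ζ₁ + 1, by positivity,
    fun t e r ht hz => ?_⟩
  set z := znorm e r with hzdef
  have hz0 : 0 ≤ z := znorm_nonneg e r
  have he : ‖e‖ ≤ z := norm_e_le_znorm e r
  have hr : ‖r‖ ≤ z := norm_r_le_znorm e r
  have hx0 : ‖S.xd t‖ ≤ R + k := (hR t ht).trans (by linarith)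
  have hx1 : ‖S.xd t + e‖ ≤ R + k := norm_add_le_of_le (hR t ht) (he.trans hz)
  have hconv : Convex ℝ (Metric.closedBall (0 : Vec (Fin n)) (R + k) ×ˢ Ici (0 : ℝ)) :=
    (convex_closedBall _ _).prod (convex_Ici 0)
  have hsub : Metric.closedBall (0 : Vec (Fin n)) (R + k) ×ˢ Ici (0 : ℝ) ⊆ spaceTime n :=
    prod_mono (subset_univ _) subset_rfl
  have hm0 : (S.xd t, t) ∈ Metric.closedBall (0 : Vec (Fin n)) (R + k) ×ˢ Ici (0 : ℝ) :=
    ⟨by simpa using hx0, ht⟩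
  have hm1 : (S.xd t + e, t) ∈ Metric.closedBall (0 : Vec (Fin n)) (R + k) ×ˢ Ici (0 : ℝ) :=
    ⟨by simpa using hx1, ht⟩
  have hdiff : ‖(S.xd t + e, t) - (S.xd t, t)‖ ≤ z := by
    rw [Prod.norm_def]
    simpa using he
  have hYdiff : ∀ i j, |(S.Y (S.xd t + e) t - S.Yd t) i j| ≤ C * z := fun i j => by
    have := hconv.norm_image_sub_le_of_norm_hasFDerivWithin_le (C := C)
      (fun p hp => (((hS.Y_contDiff i j).differentiableOn (by norm_num) p
        (hsub hp)).hasFDerivWithinAt.mono hsub))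
      (fun p hp => (hC i j p.1 p.2 (by simpa using hp.1) hp.2).2.1) hm0 hm1
    exact this.trans (mul_le_mul_of_nonneg_left hdiff hC0)
  have hYdotdiff : ∀ i j,
      |(S.Ydot (S.xd t + e) (S.xd' t + r - α • e) t - S.Yddot t) i j| ≤
        C * (R₁ + 2 + α) * z := fun i j => by
    set F := fderivWithin ℝ (fun p : Vec (Fin n) × ℝ => S.Y p.1 p.2 i j) (spaceTime n) with hF
    have h1 := hconv.norm_image_sub_le_of_norm_hasFDerivWithin_le (f := F) (C := C)
      (fun p hp => ((((hS.Y_contDiff i j).fderivWithin uniqueDiffOn_spaceTime (m := 1)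
        (by norm_num)).differentiableOn (by norm_num) p
        (hsub hp)).hasFDerivWithinAt.mono hsub))
      (fun p hp => (hC i j p.1 p.2 (by simpa using hp.1) hp.2).2.2) hm0 hm1
    -- The difference splits into a change of base point at fixed velocity and a change of velocity
    -- r - α e. They contribute C(R₁ + 1) and C(1 + α).
    have h2 : (S.Ydot (S.xd t + e) (S.xd' t + r - α • e) t - S.Yddot t) i j =
        (F (S.xd t + e, t) - F (S.xd t, t)) (S.xd' t, 1) + F (S.xd t + e, t) (r - α • e, 0) := by
      have h3 : ((S.xd' t + r - α • e, 1) : Vec (Fin n) × ℝ) =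
          (S.xd' t, 1) + (r - α • e, 0) := by
        ext1
        · simp only [Prod.fst_add]; abel
        · simp
      change F (S.xd t + e, t) (S.xd' t + r - α • e, 1) - F (S.xd t, t) (S.xd' t, 1) = _
      rw [h3, map_add, _root_.sub_apply]
      ring
    have hv : ‖((S.xd' t, 1) : Vec (Fin n) × ℝ)‖ ≤ R₁ + 1 := by
      rw [Prod.norm_def]
      exact max_le ((hR₁ t ht).trans (by linarith)) (by simp [hR₁0])
    have hv' : ‖((r - α • e, 0) : Vec (Fin n) × ℝ)‖ ≤ (1 + α) * z := by
      rw [Prod.norm_def]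
      refine max_le ?_ (by simp; positivity)
      refine (norm_sub_le _ _).trans ?_
      rw [norm_smul, Real.norm_of_nonneg hα.le]
      nlinarith
    rw [h2]
    refine (abs_add_le _ _).trans ?_
    have a1 := (ContinuousLinearMap.le_opNorm (F (S.xd t + e, t) - F (S.xd t, t))
      (S.xd' t, 1)).trans (mul_le_mul (h1.trans (mul_le_mul_of_nonneg_left hdiff hC0)) hv
        (norm_nonneg _) (by positivity))
    have a2 := (ContinuousLinearMap.le_opNorm (F (S.xd t + e, t)) (r - α • e, 0)).trans
      (mul_le_mul (hC i j _ t hx1 ht).2.1 hv' (norm_nonneg _) hC0)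
    rw [Real.norm_eq_abs] at a1 a2
    linarith
  have b1 := (norm_matVec_le hYdotdiff (S.θ t)).trans
    (mul_le_mul_of_nonneg_left (hS.θ_le t ht) (by positivity))
  have b2 := (norm_matVec_le hYdiff (S.θ' t)).trans
    (mul_le_mul_of_nonneg_left (hζ₁ t ht) (by positivity))
  refine (norm_add_le_of_le (norm_add_le_of_le b1 b2) he).trans (le_of_eq ?_)
  rw [← hN]
  ring

/-- The constants on the balls of integer radius k are joined into one function by taking k = ⌈‖z‖⌉.
-/
theorem exists_isGrowthBound (hS : S.Assumptions) {α : ℝ} (hα : 0 < α) :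
    ∃ ρ : ℝ → ℝ, S.IsGrowthBound α ρ := by
  choose c hc0 hc using fun k : ℕ => hS.exists_Ntilde_bound hα k k.cast_nonneg
  obtain ⟨ρ, hpos, hmono, hcont, htop, hle⟩ := exists_continuous_strictMono_majorant c hc0
  refine ⟨ρ, hpos, hmono.strictMonoOn _, hcont.continuousOn, htop, fun t e r ht => ?_⟩
  refine (hc ⌈znorm e r⌉₊ t e r ht (Nat.le_ceil _)).trans ?_
  have := hle (znorm e r)
  have h0 := znorm_nonneg e r
  exact mul_le_mul_of_nonneg_right (by linarith) h0

end Assumptions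

end AdaptiveSystem

/-! ### The Lyapunov function and its derivative. -/

namespace AdaptiveSystem

variable {n m : ℕ} {S : AdaptiveSystem n m}

/-- The auxiliary part `P = β ∑ |e_i| - eᵀ N_B` of the Lyapunov function. -/
def lyapP (S : AdaptiveSystem n m) (β : ℝ) (t : ℝ) (x : Vec (Fin n))
    (θhat : Vec (Fin m ⊕ Fin n)) : ℝ :=
  β * ∑ i, |S.e t x i| - inner ℝ (S.e t x) (S.NB t θhat)

/-- The Lyapunov function `‖z‖² / 2 + P`. -/
def lyap (S : AdaptiveSystem n m) (G : Gains) (t : ℝ) (x : Vec (Fin n))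
    (θhat : Vec (Fin m ⊕ Fin n)) (μ : Vec (Fin n)) : ℝ :=
  (‖S.r G t x θhat μ‖ ^ 2 + ‖S.e t x‖ ^ 2) / 2 + S.lyapP G.β t x θhat

/-- ∑ |e_i| ≥ ‖e‖, so the β-term dominates eᵀN_B. -/
theorem lyapP_nonneg {β γ₁ : ℝ} (hγ : γ₁ ≤ β) (hβ : 0 ≤ β) {t : ℝ} {x : Vec (Fin n)}
    {θhat : Vec (Fin m ⊕ Fin n)} (hN : ‖S.NB t θhat‖ ≤ γ₁) : 0 ≤ S.lyapP β t x θhat := by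
  have h1 := real_inner_le_norm (S.e t x) (S.NB t θhat)
  have h2 := norm_le_sum_abs (S.e t x)
  have h3 := mul_le_mul_of_nonneg_left (hN.trans hγ) (norm_nonneg (S.e t x))
  have h4 := mul_le_mul_of_nonneg_left h2 hβ
  rw [lyapP]
  linarith

theorem y0norm_sq {G : Gains} {γ₁ : ℝ} (hγ : γ₁ ≤ G.β) (hβ : 0 ≤ G.β) {x : Vec (Fin n)}
    {θhat : Vec (Fin m ⊕ Fin n)} (μ : Vec (Fin n)) (hN : ‖S.NB 0 θhat‖ ≤ γ₁) :
    S.y0norm G x θhat μ ^ 2 =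
      znorm (S.e 0 x) (S.r G 0 x θhat μ) ^ 2 + S.lyapP G.β 0 x θhat :=
  Real.sq_sqrt (add_nonneg (sq_nonneg _) (lyapP_nonneg hγ hβ hN))

namespace IsTrajectory

variable {G : Gains} {T : EReal} {x : ℝ → Vec (Fin n)} {θhat : ℝ → Vec (Fin m ⊕ Fin n)}
  {μ : ℝ → Vec (Fin n)}

theorem ac_lyap (h : S.IsTrajectory G T x θhat μ) (hS : S.Assumptions) {b : ℝ}
    (hb : b ∈ timeInterval T) :
    AbsolutelyContinuousOnInterval (fun t => S.lyap G t (x t) (θhat t) (μ t)) 0 b ∧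
    (∀ i, AbsolutelyContinuousOnInterval (fun t => S.e t (x t) i) 0 b) ∧
    (∀ i, AbsolutelyContinuousOnInterval (fun t => S.r G t (x t) (θhat t) (μ t) i) 0 b) := by
  obtain ⟨C, hC0, hC⟩ := hS.exists_Yd_bound
  obtain ⟨ζ₁, hζ₁⟩ := hS.θ'_le
  obtain ⟨ζ₂, hζ₂⟩ := hS.θ''_le
  obtain ⟨δ₁, hδ₁⟩ := hS.xd'_le
  obtain ⟨hx, hθhat, hμ⟩ := h.ac hb
  have hθ : AbsolutelyContinuousOnInterval S.θ 0 b := .of_norm_derivWithin_le hb.1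
    fun t ht => ⟨_, hζ₁ t ht, hS.hasDerivWithinAt_θ ht⟩
  have hθ' : AbsolutelyContinuousOnInterval S.θ' 0 b := .of_norm_derivWithin_le hb.1
    fun t ht => ⟨_, hζ₂ t ht, (hS.θ'_diff t ht).hasDerivWithinAt⟩
  have hxd : AbsolutelyContinuousOnInterval S.xd 0 b := .of_norm_derivWithin_le hb.1
    fun t ht => ⟨_, hδ₁ t ht, hS.hasDerivWithinAt_xd ht⟩
  have hYd : ∀ i j, AbsolutelyContinuousOnInterval (fun t => S.Yd t i j) 0 b := fun i j =>
    .of_norm_derivWithin_le hb.1 fun t ht =>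
      ⟨_, (hC t ht i j).2.1, hS.hasDerivWithinAt_Yd ht i j⟩
  have hYdd : ∀ i j, AbsolutelyContinuousOnInterval (fun t => S.Yddot t i j) 0 b := fun i j =>
    .of_norm_derivWithin_le hb.1 fun t ht => (hC t ht i j).2.2
  have hY : ∀ i j, AbsolutelyContinuousOnInterval (fun t => S.Y (x t) t i j) 0 b := fun i j => by
    -- On a compact time interval the trajectory stays in a ball, and there Y is Lipschitz.
    obtain ⟨R, hR⟩ := hx.exists_bound
    obtain ⟨L, hL⟩ := hS.exists_Y_lipschitz R b i j
    have hid : AbsolutelyContinuousOnInterval (fun t : ℝ => t) 0 b :=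
      (LipschitzWith.id.lipschitzOnWith (s := uIcc 0 b)).absolutelyContinuousOnInterval
    refine (hx.prodMk hid).comp_lipschitzOnWith hL fun t ht => ⟨by simpa using hR t ht, ?_⟩
    rwa [uIcc_of_le hb.1] at ht
  have he : ∀ i, AbsolutelyContinuousOnInterval (fun t => S.e t (x t) i) 0 b := fun i =>
    (hx.coord i).fun_sub (hxd.coord i)
  have hr : ∀ i, AbsolutelyContinuousOnInterval
      (fun t => S.r G t (x t) (θhat t) (μ t) i) 0 b := fun i => by
    simp only [r_eq]
    exact ((AbsolutelyContinuousOnInterval.matVec_coord hY (fun j => hθ.coord j) i).fun_sub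
      (AbsolutelyContinuousOnInterval.matVec_coord hYd (fun j => hθhat.coord j) i)).fun_add
      (hμ.coord i)
  have hNB : ∀ i, AbsolutelyContinuousOnInterval (fun t => S.NB t (θhat t) i) 0 b := fun i =>
    ((AbsolutelyContinuousOnInterval.matVec_coord hYd (fun j => hθ'.coord j) i).fun_add
      (AbsolutelyContinuousOnInterval.matVec_coord hYdd (fun j => hθ.coord j) i)).fun_sub
      (AbsolutelyContinuousOnInterval.matVec_coord hYdd (fun j => hθhat.coord j) i)
  have habs : ∀ i, AbsolutelyContinuousOnInterval (fun t => |S.e t (x t) i|) 0 b := fun i =>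
    (he i).comp_lipschitzWith (g := fun a : ℝ => |a|) lipschitzWith_one_norm
  refine ⟨?_, he, hr⟩
  have hW : (fun t => S.lyap G t (x t) (θhat t) (μ t)) = fun t =>
      (1 / 2) * ((∑ i, S.r G t (x t) (θhat t) (μ t) i * S.r G t (x t) (θhat t) (μ t) i) +
        ∑ i, S.e t (x t) i * S.e t (x t) i) +
      (G.β * (∑ i, |S.e t (x t) i|) - ∑ i, S.NB t (θhat t) i * S.e t (x t) i) := by
    ext t
    rw [lyap, lyapP, EuclideanSpace.real_norm_sq_eq, EuclideanSpace.real_norm_sq_eq,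
      PiLp.inner_apply]
    simp only [pow_two, RCLike.inner_apply, conj_trivial]
    ring
  rw [hW]
  exact (((AbsolutelyContinuousOnInterval.fun_sum _ fun i _ => (hr i).fun_mul (hr i)).fun_add
    (AbsolutelyContinuousOnInterval.fun_sum _ fun i _ => (he i).fun_mul (he i))).const_mul
    _).fun_add (((AbsolutelyContinuousOnInterval.fun_sum _ fun i _ => habs i).const_mul _).fun_sub
    (AbsolutelyContinuousOnInterval.fun_sum _ fun i _ => (hNB i).fun_mul (he i)))

end IsTrajectory

namespace VelocityAt

variable {G : Gains} {B : ℝ} {x : ℝ → Vec (Fin n)} {θhat : ℝ → Vec (Fin m ⊕ Fin n)}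
  {μ : ℝ → Vec (Fin n)} {t : ℝ} {vθ : Vec (Fin m ⊕ Fin n)} {vμ ξ : Vec (Fin n)}

theorem hasDerivAt_e (h : S.VelocityAt G B x θhat μ t vθ vμ ξ) (hS : S.Assumptions) :
    HasDerivAt (fun s => S.e s (x s))
      (S.r G t (x t) (θhat t) (μ t) - G.α • S.e t (x t)) t := by
  have := h.hasDerivAt_x.sub (hasDerivAt_of_Ici h.pos (hS.hasDerivWithinAt_xd h.pos.le))
  rw [xdot_eq] at this
  convert! this using 1
  abel

/-- The closed-loop error system. -/
theorem hasDerivAt_r (h : S.VelocityAt G B x θhat μ t vθ vμ ξ) (hS : S.Assumptions) :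
    HasDerivAt (fun s => S.r G s (x s) (θhat s) (μ s))
      (S.Ntilde G.α t (S.e t (x t)) (S.r G t (x t) (θhat t) (μ t)) + S.NB t (θhat t)
        - S.e t (x t) - G.K • S.r G t (x t) (θhat t) (μ t) - G.β • ξ) t := by
  have hY : ∀ i j, HasDerivAt (fun s => S.Y (x s) s i j)
      (S.Ydot (x t) (S.xdot G t (x t) (θhat t) (μ t)) t i j) t := fun i j =>
    hasDerivAt_of_Ici h.pos (hS.hasDerivWithinAt_Y h.pos.le h.hasDerivAt_x.hasDerivWithinAt i j)
  have hYd : ∀ i j, HasDerivAt (fun s => S.Yd s i j) (S.Yddot t i j) t := fun i j =>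
    hasDerivAt_of_Ici h.pos (hS.hasDerivWithinAt_Yd h.pos.le i j)
  have hθ := hasDerivAt_of_Ici h.pos (hS.hasDerivWithinAt_θ h.pos.le)
  have h1 := ((HasDerivAt.matVec hY hθ).sub (HasDerivAt.matVec hYd h.hasDerivAt_θhat)).add
    h.hasDerivAt_μ
  have h2 : (fun s => S.r G s (x s) (θhat s) (μ s)) =
      fun s => matVec (S.Y (x s) s) (S.θ s) - matVec (S.Yd s) (θhat s) + μ s := by
    ext1 s
    rw [r_eq]
  rw [h2]
  convert! h1 using 1
  -- Eliminating μ' makes Y_d θ̂' cancel, so the velocity of the estimate disappears from r'.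
  have h3 : vμ = matVec (S.Yd t) vθ -
      (G.K • S.r G t (x t) (θhat t) (μ t) + G.β • ξ) := by
    rw [← h.Yd_sub]; abel
  have h4 : S.xd t + S.e t (x t) = x t := by rw [e]; abel
  rw [h3, Ntilde, h4, xdot_eq, NB, sub_matVec, sub_matVec]
  abel

theorem hasDerivAt_lyap_le (h : S.VelocityAt G B x θhat μ t vθ vμ ξ) (hS : S.Assumptions)
    {γ₁ γ₂ : ℝ} (hα : 0 < G.α) (hβ : 0 < G.β) (hgain : G.β > γ₁ + γ₂ / G.α)
    (hN : ‖S.NB t (θhat t)‖ ≤ γ₁)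
    (hNd : DifferentiableAt ℝ (fun s => S.NB s (θhat s)) t)
    (hN' : ‖deriv (fun s => S.NB s (θhat s)) t‖ ≤ γ₂)
    (habs : ∀ i, DifferentiableAt ℝ (fun s => |S.e s (x s) i|) t) :
    ∃ d, HasDerivAt (fun s => S.lyap G s (x s) (θhat s) (μ s)) d t ∧
      d ≤ inner ℝ (S.r G t (x t) (θhat t) (μ t))
          (S.Ntilde G.α t (S.e t (x t)) (S.r G t (x t) (θhat t) (μ t)))
        - G.K * ‖S.r G t (x t) (θhat t) (μ t)‖ ^ 2 - G.α * ‖S.e t (x t)‖ ^ 2 := by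
  have he := h.hasDerivAt_e hS
  have hr := h.hasDerivAt_r hS
  set N := S.Ntilde G.α t (S.e t (x t)) (S.r G t (x t) (θhat t) (μ t)) with hNdef
  set N' := deriv (fun s => S.NB s (θhat s)) t with hN'def
  set ev := S.e t (x t) with hev
  set rv := S.r G t (x t) (θhat t) (μ t) with hrv
  set ed := rv - G.α • ev with hed
  have hsum : HasDerivAt (fun s => ∑ i, |S.e s (x s) i|) (inner ℝ ξ ed) t := by
    have h1 : ∀ i, HasDerivAt (fun s => |S.e s (x s) i|) (ξ i * ed i) t := fun i => by
      have hei : HasDerivAt (fun s => S.e s (x s) i) (ed i) t := by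
        simpa using hasDerivWithinAt_vec.1 (he.hasDerivWithinAt (s := univ)) i
      rw [← hasDerivAt_abs_comp_eq hei (habs i).hasDerivAt (h.eq_sign i)]
      exact (habs i).hasDerivAt
    have h2 := HasDerivAt.fun_sum (u := Finset.univ) fun i _ => h1 i
    convert! h2 using 1
    rw [PiLp.inner_apply]
    exact Finset.sum_congr rfl fun i _ => by simp [mul_comm]
  have hW := ((hr.norm_sq.add he.norm_sq).div_const 2).add
    ((hsum.const_mul G.β).sub (he.inner ℝ hNd.hasDerivAt))
  refine ⟨_, hW, ?_⟩
  -- In fact ξᵀe = ∑ |e_i|: coordinates with e_i = 0 contribute nothing whatever ξ_i is.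
  have hξ : ‖ev‖ ≤ inner ℝ ξ ev := by
    refine (norm_le_sum_abs ev).trans_eq ?_
    rw [PiLp.inner_apply]
    refine Finset.sum_congr rfl fun i _ => ?_
    by_cases hi : ev i = 0
    · simp [hi]
    · rw [h.eq_sign i hi]
      rcases lt_or_gt_of_ne hi with hi | hi
      · simp [← hev, Real.sign_of_neg hi, abs_of_neg hi]
      · simp [← hev, Real.sign_of_pos hi, abs_of_pos hi]
  have h1 : inner ℝ ev (S.NB t (θhat t)) ≤ ‖ev‖ * γ₁ :=
    (real_inner_le_norm _ _).trans (mul_le_mul_of_nonneg_left hN (norm_nonneg _))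
  have h2 : -(‖ev‖ * γ₂) ≤ inner ℝ ev N' :=
    (neg_le_neg (mul_le_mul_of_nonneg_left hN' (norm_nonneg _))).trans
      (neg_le_of_abs_le (abs_real_inner_le_norm _ _))
  have h3 : G.α * γ₁ + γ₂ ≤ G.α * G.β := by
    have : G.α * (γ₁ + γ₂ / G.α) ≤ G.α * G.β := mul_le_mul_of_nonneg_left hgain.le hα.le
    rwa [mul_add, mul_div_cancel₀ _ hα.ne'] at this
  have h4 : G.α * G.β * ‖ev‖ ≤ G.α * G.β * inner ℝ ξ ev :=
    mul_le_mul_of_nonneg_left hξ (by positivity)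
  have h5 := mul_le_mul_of_nonneg_right h3 (norm_nonneg ev)
  have h6 := mul_le_mul_of_nonneg_left h1 hα.le
  -- All terms rᵀN_B, rᵀξ and rᵀe cancel. The last bracket on the right is at most (α γ₁ + γ₂ -
  -- αβ)‖e‖, hence nonpositive by the gain condition.
  have e1 : (2 * inner ℝ rv (N + S.NB t (θhat t) - ev - G.K • rv - G.β • ξ) +
      2 * inner ℝ ev ed) / 2 +
      (G.β * inner ℝ ξ ed - (inner ℝ ev N' + inner ℝ ed (S.NB t (θhat t)))) =
      inner ℝ rv N - G.K * ‖rv‖ ^ 2 - G.α * ‖ev‖ ^ 2 +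
      (G.α * inner ℝ ev (S.NB t (θhat t)) - inner ℝ ev N' - G.α * G.β * inner ℝ ξ ev) := by
    simp only [hed, inner_add_right, inner_sub_right, inner_sub_left, inner_smul_right,
      real_inner_smul_left, real_inner_self_eq_norm_sq]
    rw [real_inner_comm ev rv, real_inner_comm rv ξ]
    ring
  refine e1.trans_le ?_
  linarith

end VelocityAt

end AdaptiveSystem

/-! ### Trapping of the errors and convergence of e. -/

/-- A continuous function that cannot leave `(-∞, s₁]` before exceeding `s₀ < s₁` stays below
`s₀`. -/
theorem le_of_continuousOn_of_trap {z : ℝ → ℝ} {b s₀ s₁ : ℝ} (hb : 0 ≤ b)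
    (hz : ContinuousOn z (Icc 0 b)) (hs : s₀ < s₁)
    (h : ∀ τ ∈ Icc 0 b, (∀ σ, 0 ≤ σ → σ < τ → z σ ≤ s₁) → z τ ≤ s₀) : z b ≤ s₀ := by
  by_contra! hgt
  have hcomp : IsCompact (Icc 0 b ∩ z ⁻¹' Ici (min s₁ (z b))) :=
    isCompact_Icc.of_isClosed_subset
      (hz.preimage_isClosed_of_isClosed isClosed_Icc isClosed_Ici) inter_subset_left
  -- At the first time `τ` at which the level min(s₁, z(b)) > s₀ is reached, the past lies below s₁,
  -- so the hypothesis gives z(τ) ≤ s₀.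
  obtain ⟨τ, ⟨hτ, hzτ⟩, hmin⟩ := hcomp.exists_isLeast
    ⟨b, right_mem_Icc.2 hb, min_le_right s₁ (z b)⟩
  have h1 := h τ hτ fun σ h0 hστ => by
    by_contra! hlt
    exact (hmin ⟨⟨h0, hστ.le.trans hτ.2⟩, (min_le_left _ _).trans hlt.le⟩).not_gt hστ
  exact ((lt_min hs hgt).trans_le hzτ).not_ge h1

/-- A nonnegative function with one-sided bounded decrease tends to zero if it forces a
nonnegative function to decrease. -/
theorem tendsto_zero_of_forced_decrease {φ W : ℝ → ℝ} {κ L : ℝ} (hκ : 0 < κ) (hL : 0 < L)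
    (hφ : ∀ t, 0 ≤ t → 0 ≤ φ t) (hW : ∀ t, 0 ≤ t → 0 ≤ W t)
    (hdec : ∀ s t, 0 ≤ s → s ≤ t → φ s - L * (t - s) ≤ φ t)
    (hforce : ∀ a b c, 0 ≤ a → a ≤ b → (∀ t ∈ Icc a b, c ≤ φ t) →
      W b - W a ≤ -(κ * c) * (b - a)) : Tendsto φ atTop (𝓝 0) := by
  have hanti : ∀ a b, 0 ≤ a → a ≤ b → W b ≤ W a := fun a b ha hab => by
    have := hforce a b 0 ha hab fun t ht => hφ t (ha.trans ht.1)
    linarith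
  have hlim : Tendsto (fun t => W (max t 0)) atTop (𝓝 (⨅ t, W (max t 0))) :=
    tendsto_atTop_ciInf
      (fun a b hab => hanti _ _ (le_max_right _ _) (max_le_max_right 0 hab))
      ⟨0, by rintro _ ⟨t, rfl⟩; exact hW _ (le_max_right _ _)⟩
  refine Metric.tendsto_atTop.2 fun ε hε => ?_
  -- If φ(t) ≥ ε, then φ ≥ ε/2 on [t, t + δ], which costs W at least κ(ε/2)δ. As W converges, this
  -- is impossible for large t.
  set δ := ε / (2 * L) with hδ
  have hδ0 : 0 < δ := by positivity
  have hdiff : Tendsto (fun t => W (max t 0) - W (max (t + δ) 0)) atTop (𝓝 0) := by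
    have := hlim.sub (hlim.comp (tendsto_atTop_add_const_right atTop δ tendsto_id))
    simpa using this
  obtain ⟨t₀, ht₀⟩ := eventually_atTop.1
    (hdiff.eventually_lt_const (show (0 : ℝ) < κ * (ε / 2) * δ by positivity))
  refine ⟨max t₀ 0, fun t ht => ?_⟩
  have ht0 : 0 ≤ t := (le_max_right _ _).trans ht
  rw [Real.dist_eq, sub_zero, abs_of_nonneg (hφ t ht0)]
  by_contra! hge
  have h1 := hforce t (t + δ) (ε / 2) ht0 (by linarith) fun s hs => by
    have h2 := hdec t s ht0 hs.1
    have h3 : L * (s - t) ≤ L * δ := mul_le_mul_of_nonneg_left (by linarith [hs.2]) hL.le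
    have h4 : L * δ = ε / 2 := by rw [hδ]; field_simp
    linarith
  have h2 := ht₀ t ((le_max_left _ _).trans ht)
  rw [max_eq_left ht0, max_eq_left (by linarith)] at h2
  have h3 : t + δ - t = δ := by ring
  rw [h3] at h1
  linarith

namespace AdaptiveSystem

variable {n m : ℕ} {S : AdaptiveSystem n m}

/-- The Lyapunov function decays at rate `κ ‖z‖²` as long as `‖z‖ ≤ s`. -/
def DecayOn (S : AdaptiveSystem n m) (α K κ s : ℝ) : Prop :=
  ∀ t e r, 0 ≤ t → znorm e r ≤ s →
    inner ℝ r (S.Ntilde α t e r) - K * ‖r‖ ^ 2 - α * ‖e‖ ^ 2 ≤ -κ * znorm e r ^ 2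

namespace IsTrajectory

variable {G : Gains} {T : EReal} {x : ℝ → Vec (Fin n)} {θhat : ℝ → Vec (Fin m ⊕ Fin n)}
  {μ : ℝ → Vec (Fin n)} {γ₁ γ₂ κ s₀ s₁ : ℝ}

/-- The case c = 0 gives monotonicity of the Lyapunov function, used for trapping. A positive lower
bound c for ‖e‖² gives the decrease that forces e → 0. -/
theorem lyap_sub_le (h : S.IsTrajectory G T x θhat μ) (hS : S.Assumptions)
    (hN : S.NBBound γ₁ γ₂ T θhat) (hα : 0 < G.α) (hβ : 0 < G.β) (hgain : G.β > γ₁ + γ₂ / G.α)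
    (hκ : 0 < κ) (H : S.DecayOn G.α G.K κ s₁) {a b c : ℝ} (ha : 0 ≤ a) (hab : a ≤ b)
    (hb : b ∈ timeInterval T)
    (hz : ∀ t ∈ Ioo a b, znorm (S.e t (x t)) (S.r G t (x t) (θhat t) (μ t)) ≤ s₁)
    (hc : ∀ t ∈ Ioo a b, c ≤ ‖S.e t (x t)‖ ^ 2) :
    S.lyap G b (x b) (θhat b) (μ b) - S.lyap G a (x a) (θhat a) (μ a) ≤ -(κ * c) * (b - a) := by
  obtain ⟨B, -, hB⟩ := hS.exists_Λ₀_bound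
  obtain ⟨hW, he, -⟩ := h.ac_lyap hS hb
  have habs : ∀ᵐ t : ℝ, ∀ i, t ∈ uIcc 0 b → DifferentiableAt ℝ (fun s => |S.e s (x s) i|) t :=
    ae_all_iff.2 fun i => ((he i).comp_lipschitzWith (g := fun a : ℝ => |a|)
      lipschitzWith_one_norm).ae_differentiableAt
  refine (hW.mono ?_).sub_le_of_ae_hasDerivAt_le hab ?_
  · rw [uIcc_of_le hab, uIcc_of_le hb.1]
    exact Icc_subset_Icc_left ha
  · filter_upwards [h.ae_velocityAt hS hβ hB, hN.deriv_le, habs] with t hv hN' habs ht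
    have ht0 : 0 ≤ t := ha.trans ht.1.le
    have htT : t ∈ timeInterval T := mem_timeInterval_of_le hb ht0 ht.2.le
    obtain ⟨vθ, vμ, ξ, hv⟩ := hv htT
    obtain ⟨d, hd, hdle⟩ := hv.hasDerivAt_lyap_le hS hα hβ hgain (hN.le t htT) (hN' htT).1
      (hN' htT).2 fun i => habs i (by rw [uIcc_of_le hb.1]; exact ⟨ht0, ht.2.le⟩)
    refine ⟨d, hd, (hdle.trans (H t _ _ ht0 (hz t ht))).trans ?_⟩
    rw [znorm_sq]
    nlinarith [hc t ht, sq_nonneg ‖S.r G t (x t) (θhat t) (μ t)‖]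

/-- A trajectory starting in the region of attraction never leaves it. -/
theorem znorm_le (h : S.IsTrajectory G T x θhat μ) (hS : S.Assumptions)
    (hN : S.NBBound γ₁ γ₂ T θhat) (hα : 0 < G.α) (hβ : 0 < G.β) (hγ : γ₁ ≤ G.β)
    (hgain : G.β > γ₁ + γ₂ / G.α) (hκ : 0 < κ) (hs₀ : 0 ≤ s₀) (hs : s₀ < s₁)
    (H : S.DecayOn G.α G.K κ s₁)
    (hy : 0 ∈ timeInterval T → Real.sqrt 2 * S.y0norm G (x 0) (θhat 0) (μ 0) ≤ s₀) {t : ℝ}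
    (ht : t ∈ timeInterval T) : znorm (S.e t (x t)) (S.r G t (x t) (θhat t) (μ t)) ≤ s₀ := by
  have h0 : 0 ∈ timeInterval T := mem_timeInterval_of_le ht le_rfl ht.1
  obtain ⟨-, he, hr⟩ := h.ac_lyap hS ht
  refine le_of_continuousOn_of_trap
    (z := fun t => znorm (S.e t (x t)) (S.r G t (x t) (θhat t) (μ t))) ht.1 ?_ hs
    fun τ hτ hz => ?_
  · simp only [znorm, EuclideanSpace.real_norm_sq_eq]
    have he' := fun i => (he i).continuousOn
    have hr' := fun i => (hr i).continuousOn
    rw [uIcc_of_le ht.1] at he' hr'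
    exact ((continuousOn_finsetSum _ fun i _ => (hr' i).pow 2).add
      (continuousOn_finsetSum _ fun i _ => (he' i).pow 2)).sqrt
  · have hτT := mem_timeInterval_of_le ht hτ.1 hτ.2
    have h1 := h.lyap_sub_le hS hN hα hβ hgain hκ H (c := 0) le_rfl hτ.1 hτT
      (fun σ hσ => hz σ hσ.1.le hσ.2) fun σ _ => sq_nonneg _
    have h2 := lyapP_nonneg hγ hβ.le (hN.le τ hτT) (x := x τ)
    have h3 := lyapP_nonneg hγ hβ.le (hN.le 0 h0) (x := x 0)
    have h4 := y0norm_sq hγ hβ.le (x := x 0) (μ 0) (hN.le 0 h0)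
    -- The chain is ‖z(τ)‖²/2 ≤ V(τ) ≤ V(0) ≤ ‖y(0)‖². V halves ‖z‖² while ‖y‖² does not, hence the
    -- factor √2.
    have h5 : (Real.sqrt 2 * S.y0norm G (x 0) (θhat 0) (μ 0)) ^ 2 ≤ s₀ ^ 2 :=
      pow_le_pow_left₀ (mul_nonneg (Real.sqrt_nonneg _) (Real.sqrt_nonneg _)) (hy h0) 2
    rw [mul_pow, Real.sq_sqrt zero_le_two, h4] at h5
    refine abs_le_of_sq_le_sq' ?_ hs₀ |>.2
    rw [znorm_sq] at h5 ⊢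
    simp only [lyap] at h1
    have h6 := sq_nonneg ‖S.e 0 (x 0)‖
    have h7 := sq_nonneg ‖S.r G 0 (x 0) (θhat 0) (μ 0)‖
    linarith

/-- The derivative of -‖e‖² is -2eᵀ(r - α e), at most 2(1 + α)s₀². The `+ 1` keeps the rate positive
when s₀ = 0, as `tendsto_zero_of_forced_decrease` requires. -/
theorem norm_e_sq_sub_le (h : S.IsTrajectory G T x θhat μ) (hS : S.Assumptions)
    (hα : 0 < G.α) (hβ : 0 < G.β) (hs₀ : 0 ≤ s₀)
    (hz : ∀ t ∈ timeInterval T, znorm (S.e t (x t)) (S.r G t (x t) (θhat t) (μ t)) ≤ s₀)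
    {a b : ℝ} (ha : 0 ≤ a) (hab : a ≤ b) (hb : b ∈ timeInterval T) :
    ‖S.e a (x a)‖ ^ 2 - (2 * (1 + G.α) * s₀ ^ 2 + 1) * (b - a) ≤ ‖S.e b (x b)‖ ^ 2 := by
  obtain ⟨B, -, hB⟩ := hS.exists_Λ₀_bound
  obtain ⟨-, he, -⟩ := h.ac_lyap hS hb
  have hac : AbsolutelyContinuousOnInterval (fun t => -(‖S.e t (x t)‖ ^ 2)) 0 b := by
    have hE : (fun t => -(‖S.e t (x t)‖ ^ 2)) =
        fun t => -∑ i, S.e t (x t) i * S.e t (x t) i := by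
      ext t
      rw [EuclideanSpace.real_norm_sq_eq]
      simp only [pow_two]
    rw [hE]
    exact (AbsolutelyContinuousOnInterval.fun_sum _ fun i _ => (he i).fun_mul (he i)).fun_neg
  have := (hac.mono (c := a) (d := b) ?_).sub_le_of_ae_hasDerivAt_le hab
    (c := 2 * (1 + G.α) * s₀ ^ 2 + 1) ?_
  · linarith
  · rw [uIcc_of_le hab, uIcc_of_le hb.1]
    exact Icc_subset_Icc_left ha
  · filter_upwards [h.ae_velocityAt hS hβ hB] with t hv ht
    have htT : t ∈ timeInterval T := mem_timeInterval_of_le hb (ha.trans ht.1.le) ht.2.le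
    obtain ⟨vθ, vμ, ξ, hv⟩ := hv htT
    refine ⟨_, (hv.hasDerivAt_e hS).norm_sq.neg, ?_⟩
    have h1 := (norm_e_le_znorm _ _).trans (hz t htT)
    have h2 := (norm_r_le_znorm _ _).trans (hz t htT)
    have h3 := neg_le_of_abs_le (abs_real_inner_le_norm (S.e t (x t))
      (S.r G t (x t) (θhat t) (μ t)))
    have h4 := mul_le_mul h1 h2 (norm_nonneg _) hs₀
    have h5 := mul_le_mul_of_nonneg_left (pow_le_pow_left₀ (norm_nonneg _) h1 2) hα.le
    rw [inner_sub_right, inner_smul_right, real_inner_self_eq_norm_sq]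
    linarith

theorem tendsto_norm_e (h : S.IsTrajectory G ⊤ x θhat μ) (hS : S.Assumptions)
    (hN : S.NBBound γ₁ γ₂ ⊤ θhat) (hα : 0 < G.α) (hβ : 0 < G.β) (hγ : γ₁ ≤ G.β)
    (hgain : G.β > γ₁ + γ₂ / G.α) (hκ : 0 < κ) (hs₀ : 0 ≤ s₀)
    (H : S.DecayOn G.α G.K κ s₀)
    (hz : ∀ t ∈ timeInterval ⊤, znorm (S.e t (x t)) (S.r G t (x t) (θhat t) (μ t)) ≤ s₀) :
    Tendsto (fun t => ‖S.e t (x t)‖) atTop (𝓝 0) := by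
  have hT : ∀ t : ℝ, 0 ≤ t → t ∈ timeInterval ⊤ := fun t ht => ⟨ht, EReal.coe_lt_top t⟩
  have := tendsto_zero_of_forced_decrease (φ := fun t => ‖S.e t (x t)‖ ^ 2)
    (W := fun t => S.lyap G t (x t) (θhat t) (μ t)) hκ
    (show 0 < 2 * (1 + G.α) * s₀ ^ 2 + 1 by positivity) (fun t _ => sq_nonneg _)
    (fun t ht => add_nonneg (by positivity) (lyapP_nonneg hγ hβ.le (hN.le t (hT t ht))))
    (fun s t hs hst => h.norm_e_sq_sub_le hS hα hβ hs₀ hz hs hst (hT t (hs.trans hst)))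
    fun a b c ha hab hc => h.lyap_sub_le hS hN hα hβ hgain hκ H ha hab (hT b (ha.trans hab))
      (fun t ht => hz t (hT t (ha.trans ht.1.le))) fun t ht => hc t (Ioo_subset_Icc_self ht)
  have h2 := this.sqrt
  simpa [Real.sqrt_sq (norm_nonneg _)] using h2

end IsTrajectory

/-! ### Boundedness of all signals and choice of the gains. -/

/-- A bound on the errors bounds all closed-loop signals. -/
theorem Assumptions.exists_signalsBounded (hS : S.Assumptions) (G : Gains) (hα : 0 < G.α)
    (hβ : 0 < G.β) {s₀ : ℝ} (hs₀ : 0 ≤ s₀) : ∃ M : ℝ, ∀ T x θhat μ,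
      S.IsTrajectory G T x θhat μ →
      (∀ t ∈ timeInterval T, znorm (S.e t (x t)) (S.r G t (x t) (θhat t) (μ t)) ≤ s₀) →
      S.SignalsBounded G M T x θhat μ := by
  obtain ⟨B, hB0, hB⟩ := hS.exists_Λ₀_bound
  obtain ⟨D, hD0, hD⟩ := hS.exists_Yd_bound
  obtain ⟨R, hR⟩ := hS.xd_le
  obtain ⟨R₁, hR₁⟩ := hS.xd'_le
  obtain ⟨C, hC0, hC⟩ := hS.exists_Y_bound (R + s₀)
  have hR0 : 0 ≤ R := (norm_nonneg _).trans (hR 0 le_rfl)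
  have hR₁0 : 0 ≤ R₁ := (norm_nonneg _).trans (hR₁ 0 le_rfl)
  have hθ0 := hS.θbar_pos
  set N : ℝ := Fintype.card (Fin n) * Fintype.card (Fin m ⊕ Fin n) with hNdef
  have hN0 : 0 ≤ N := by positivity
  have p1 : 0 ≤ G.α * s₀ := by positivity
  have p2 : 0 ≤ N * C * S.θbar := by positivity
  have p3 : 0 ≤ N * D * S.θbar := by positivity
  have p4 : 0 ≤ B * G.β := by positivity
  have p5 : 0 ≤ N * D * (B * G.β) := by positivity
  have p6 : 0 ≤ |G.K| * s₀ := by positivity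
  have p7 : 0 ≤ G.β * n := by positivity
  refine ⟨R + R₁ + s₀ + G.α * s₀ + N * C * S.θbar + N * D * S.θbar + 2 * S.θbar + C + D +
    B * G.β + N * D * (B * G.β) + |G.K| * s₀ + G.β * n, fun T x θhat μ h hz => ?_⟩
  have he : ∀ t ∈ timeInterval T, ‖S.e t (x t)‖ ≤ s₀ := fun t ht =>
    (norm_e_le_znorm _ _).trans (hz t ht)
  have hr : ∀ t ∈ timeInterval T, ‖S.r G t (x t) (θhat t) (μ t)‖ ≤ s₀ := fun t ht =>
    (norm_r_le_znorm _ _).trans (hz t ht)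
  have hx : ∀ t ∈ timeInterval T, ‖x t‖ ≤ R + s₀ := fun t ht => by
    have : x t = S.xd t + S.e t (x t) := by rw [e]; abel
    rw [this]
    exact norm_add_le_of_le (hR t ht.1) (he t ht)
  have hxdot : ∀ t ∈ timeInterval T,
      ‖S.xdot G t (x t) (θhat t) (μ t)‖ ≤ R₁ + s₀ + G.α * s₀ := fun t ht => by
    rw [xdot_eq]
    refine norm_sub_le_of_le (norm_add_le_of_le (hR₁ t ht.1) (hr t ht)) ?_
    rw [norm_smul, Real.norm_of_nonneg hα.le]
    exact mul_le_mul_of_nonneg_left (he t ht) hα.le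
  have hYθ : ∀ t ∈ timeInterval T, ‖matVec (S.Y (x t) t) (S.θ t)‖ ≤ N * C * S.θbar :=
    fun t ht => (norm_matVec_le (fun i j => (hC i j _ t (hx t ht) ht.1).1) _).trans
      (mul_le_mul_of_nonneg_left (hS.θ_le t ht.1) (by positivity))
  have hθhat : ∀ t ∈ timeInterval T, ‖θhat t‖ ≤ S.θbar := fun t ht => h.norm_θhat_le hS hβ ht
  have hYd : ∀ t ∈ timeInterval T, ∀ v : Vec (Fin m ⊕ Fin n), ∀ a, ‖v‖ ≤ a →
      ‖matVec (S.Yd t) v‖ ≤ N * D * a := fun t ht v a hv =>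
    (norm_matVec_le (fun i j => (hD t ht.1 i j).1) _).trans
      (mul_le_mul_of_nonneg_left hv (by positivity))
  constructor
  · intro t ht
    linarith [hx t ht]
  · intro t ht
    linarith [hxdot t ht]
  · intro t ht
    linarith [he t ht]
  · intro t ht
    linarith [hr t ht]
  · intro t ht
    have h1 : S.u G t (x t) (θhat t) (μ t) =
        S.xdot G t (x t) (θhat t) (μ t) - matVec (S.Y (x t) t) (S.θ t) := by
      rw [xdot]; abel
    rw [h1]
    linarith [norm_sub_le_of_le (hxdot t ht) (hYθ t ht)]
  · intro t ht
    -- μ is recovered algebraically from r and the regressors. Integrating its own law would give a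
    -- bound growing with time.
    have h1 : μ t = S.r G t (x t) (θhat t) (μ t) - matVec (S.Y (x t) t) (S.θ t) +
        matVec (S.Yd t) (θhat t) := by
      rw [r_eq]; abel
    rw [h1]
    linarith [norm_add_le_of_le (norm_sub_le_of_le (hr t ht) (hYθ t ht))
      (hYd t ht _ _ (hθhat t ht))]
  · exact hθhat
  · intro t ht
    linarith [norm_sub_le_of_le (hS.θ_le t ht.1) (hθhat t ht)]
  · intro t ht i j
    linarith [(hC i j _ t (hx t ht) ht.1).1]
  · intro t ht i j
    linarith [(hD t ht.1 i j).1]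
  · filter_upwards [h.ae_velocityAt hS hβ hB] with t hv ht
    obtain ⟨vθ, vμ, ξ, hv⟩ := hv ht
    rw [hv.hasDerivAt_θhat.deriv]
    linarith [hv.norm_le]
  · filter_upwards [h.ae_velocityAt hS hβ hB] with t hv ht
    obtain ⟨vθ, vμ, ξ, hv⟩ := hv ht
    rw [hv.hasDerivAt_μ.deriv]
    have h1 : vμ = matVec (S.Yd t) vθ - (G.K • S.r G t (x t) (θhat t) (μ t) + G.β • ξ) := by
      rw [← hv.Yd_sub]; abel
    have hξ : ‖ξ‖ ≤ n := (norm_le_sum_abs ξ).trans <|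
      (Finset.sum_le_sum fun i _ => hv.abs_le i).trans_eq (by simp)
    have h2 : ‖G.K • S.r G t (x t) (θhat t) (μ t)‖ ≤ |G.K| * s₀ := by
      rw [norm_smul, Real.norm_eq_abs]
      exact mul_le_mul_of_nonneg_left (hr t ht) (abs_nonneg _)
    have h3 : ‖G.β • ξ‖ ≤ G.β * n := by
      rw [norm_smul, Real.norm_of_nonneg hβ.le]
      exact mul_le_mul_of_nonneg_left hξ hβ.le
    rw [h1]
    linarith [norm_sub_le_of_le (hYd t ht _ _ hv.norm_le) (norm_add_le_of_le h2 h3)]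

theorem DecayOn.mono {α K κ s s' : ℝ} (H : S.DecayOn α K κ s) (h : s' ≤ s) :
    S.DecayOn α K κ s' := fun t e r ht hz => H t e r ht (hz.trans h)

/-- Trajectories starting in a region of decay of the Lyapunov function stay bounded and converge. -/
theorem Assumptions.exists_bound_of_decayOn (hS : S.Assumptions) {α β K γ₁ γ₂ κ s₀ s₁ : ℝ}
    (hα : 0 < α) (hβ : 0 < β) (hγ₂ : 0 < γ₂) (hgain : β > γ₁ + γ₂ / α) (hκ : 0 < κ)
    (hs₀ : 0 ≤ s₀) (hs : s₀ < s₁) (H : S.DecayOn α K κ s₁) :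
    ∃ M : ℝ, ∀ T x θhat μ, S.IsTrajectory ⟨α, β, K⟩ T x θhat μ → S.NBBound γ₁ γ₂ T θhat →
      (0 ∈ timeInterval T →
        Real.sqrt 2 * S.y0norm ⟨α, β, K⟩ (x 0) (θhat 0) (μ 0) ≤ s₀) →
      S.SignalsBounded ⟨α, β, K⟩ M T x θhat μ ∧
        (T = ⊤ → Tendsto (fun t => ‖S.e t (x t)‖) atTop (𝓝 0)) := by
  have hγ : γ₁ ≤ β := by have := div_pos hγ₂ hα; linarith
  obtain ⟨M, hM⟩ := hS.exists_signalsBounded ⟨α, β, K⟩ hα hβ hs₀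
  refine ⟨M, fun T x θhat μ h hN hy => ?_⟩
  have hz := fun t (ht : t ∈ timeInterval T) =>
    h.znorm_le hS hN hα hβ hγ hgain hκ hs₀ hs H hy ht
  refine ⟨hM T x θhat μ h hz, ?_⟩
  rintro rfl
  exact h.tendsto_norm_e hS hN hα hβ hγ hgain hκ hs₀ (H.mono hs.le) hz

theorem IsGrowthBound.inner_le {α : ℝ} {ρ : ℝ → ℝ} (hρ : S.IsGrowthBound α ρ) {s t : ℝ}
    {e r : Vec (Fin n)} (ht : 0 ≤ t) (hz : znorm e r ≤ s) :
    inner ℝ r (S.Ntilde α t e r) ≤ ‖r‖ * (ρ s * znorm e r) := by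
  have h0 := znorm_nonneg e r
  refine (real_inner_le_norm _ _).trans (mul_le_mul_of_nonneg_left ?_ (norm_nonneg _))
  exact (hρ.le t e r ht).trans (mul_le_mul_of_nonneg_right
    (hρ.strictMono.monotoneOn h0 (h0.trans hz) hz) h0)

/-- Young's inequality ‖r‖ρ‖z‖ ≤ ‖r‖²/2 + ρ²‖z‖²/2 uses up half a unit of K, hence K - 1/2. The rate
is positive only under the condition on the region of attraction. -/
theorem IsGrowthBound.decayOn {α K : ℝ} {ρ : ℝ → ℝ} (hρ : S.IsGrowthBound α ρ) (s : ℝ) :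
    S.DecayOn α K (min α (K - 1 / 2) - ρ s ^ 2 / 2) s := by
  intro t e r ht hz
  have h1 := hρ.inner_le ht hz
  have h2 := mul_le_mul_of_nonneg_right (min_le_left α (K - 1 / 2)) (sq_nonneg ‖e‖)
  have h3 := mul_le_mul_of_nonneg_right (min_le_right α (K - 1 / 2)) (sq_nonneg ‖r‖)
  have h4 := znorm_sq e r
  have h5 := sq_nonneg (‖r‖ - ρ s * znorm e r)
  have h6 : ρ s ^ 2 / 2 * znorm e r ^ 2 = (ρ s * znorm e r) ^ 2 / 2 := by ring
  rw [neg_mul, sub_mul, h6]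
  rw [h4]
  linarith

/-- In the semi-global claim α is fixed, so ρ²/2 < min{α, K - 1/2} cannot be reached by raising K
alone. Weighting Young's inequality by α puts ρ² on ‖r‖², where K acts, and leaves half of the
damping α‖z‖². -/
theorem IsGrowthBound.decayOn_of_large_gain {α K : ℝ} (hα : 0 < α) {ρ : ℝ → ℝ}
    (hρ : S.IsGrowthBound α ρ) (s : ℝ) (hK : ρ s ^ 2 / (2 * α) + α ≤ K) :
    S.DecayOn α K (α / 2) s := by
  intro t e r ht hz
  have h1 := hρ.inner_le ht hz
  have h3 := mul_le_mul_of_nonneg_right hK (sq_nonneg ‖r‖)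
  have h4 := znorm_sq e r
  have h5 := sq_nonneg (ρ s * ‖r‖ - α * znorm e r)
  have h6 : ‖r‖ * (ρ s * znorm e r) ≤ ρ s ^ 2 / (2 * α) * ‖r‖ ^ 2 + α / 2 * znorm e r ^ 2 := by
    have : ρ s ^ 2 / (2 * α) * ‖r‖ ^ 2 + α / 2 * znorm e r ^ 2 - ‖r‖ * (ρ s * znorm e r) =
        (ρ s * ‖r‖ - α * znorm e r) ^ 2 / (2 * α) := by
      field_simp
      ring
    have h7 : 0 ≤ (ρ s * ‖r‖ - α * znorm e r) ^ 2 / (2 * α) := by positivity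
    linarith
  rw [h4] at h6 ⊢
  linarith

/-- A bound on the initial tracking error bounds `‖y(0)‖`, uniformly in the gain `K`. -/
theorem Assumptions.exists_y0norm_le (hS : S.Assumptions) {α β γ₁ : ℝ} (hβ : 0 < β)
    (hγ₁ : 0 < γ₁) {R : ℝ} (hR : 0 < R) : ∃ s : ℝ, 0 ≤ s ∧ ∀ K x θhat,
      ‖S.e 0 x‖ ≤ R → ‖θhat‖ ≤ S.θbar → ‖S.NB 0 θhat‖ ≤ γ₁ →
      Real.sqrt 2 * S.y0norm ⟨α, β, K⟩ x θhat 0 ≤ s := by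
  obtain ⟨D, hD0, hD⟩ := hS.exists_Yd_bound
  obtain ⟨C, hC0, hC⟩ := hS.exists_Y_bound (‖S.xd 0‖ + R)
  have hθ0 := hS.θbar_pos
  set N : ℝ := Fintype.card (Fin n) * Fintype.card (Fin m ⊕ Fin n) with hNdef
  set Q := N * C * S.θbar + N * D * S.θbar with hQ
  have hQ0 : 0 ≤ Q := by positivity
  refine ⟨Real.sqrt 2 * Real.sqrt (Q ^ 2 + R ^ 2 + (β * (n * R) + R * γ₁)), by positivity,
    fun K x θhat he hθhat hN => mul_le_mul_of_nonneg_left ?_ (Real.sqrt_nonneg _)⟩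
  refine Real.sqrt_le_sqrt ?_
  have hx : ‖x‖ ≤ ‖S.xd 0‖ + R := by
    have : x = S.xd 0 + S.e 0 x := by rw [e]; abel
    rw [this]
    exact norm_add_le_of_le le_rfl he
  have hr : ‖S.r ⟨α, β, K⟩ 0 x θhat 0‖ ≤ Q := by
    -- In this form r contains no gain, and μ(0) = 0, so r(0) is bounded independently of K. This is
    -- what allows K to be chosen after the radius.
    rw [r_eq, add_zero]
    refine norm_sub_le_of_le ?_ ?_
    · exact (norm_matVec_le (fun i j => (hC i j _ 0 hx le_rfl).1) _).trans
        (mul_le_mul_of_nonneg_left (hS.θ_le 0 le_rfl) (by positivity))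
    · exact (norm_matVec_le (fun i j => (hD 0 le_rfl i j).1) _).trans
        (mul_le_mul_of_nonneg_left hθhat (by positivity))
  have hsum : ∑ i, |S.e 0 x i| ≤ n * R :=
    (Finset.sum_le_sum fun i _ => (abs_coord_le_norm _ i).trans he).trans_eq (by simp)
  have hin := neg_le_of_abs_le ((abs_real_inner_le_norm (S.e 0 x) (S.NB 0 θhat)).trans
    (mul_le_mul he hN (norm_nonneg _) hR.le))
  have h1 := pow_le_pow_left₀ (norm_nonneg _) hr 2
  have h2 := pow_le_pow_left₀ (norm_nonneg _) he 2
  have h3 := mul_le_mul_of_nonneg_left hsum hβ.le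
  rw [znorm_sq]
  simp only
  linarith

end AdaptiveSystem

end

/-! ### Assembly of the theorem. -/

theorem theorem1 (n m : ℕ) (S : AdaptiveSystem n m) (hS : S.Assumptions) :
    -- the constants of the gain condition exist, for every choice of the gains
    (∃ γ₁ : ℝ, 0 < γ₁ ∧ ∀ β : ℝ, 0 < β → ∃ γ₂ : ℝ, 0 < γ₂ ∧
      ∀ α K : ℝ, 0 < α → 0 < K → ∀ T x θhat μ,
        S.IsTrajectory ⟨α, β, K⟩ T x θhat μ → S.NBBound γ₁ γ₂ T θhat) ∧
    -- so does the function bounding the state-dependent disturbance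
    (∀ α : ℝ, 0 < α → ∃ ρ : ℝ → ℝ, S.IsGrowthBound α ρ) ∧
    ∀ α β γ₁ γ₂ : ℝ, 0 < α → 0 < β → 0 < γ₁ → 0 < γ₂ → β > γ₁ + γ₂ / α →
      -- region of attraction for given gains
      (∀ K : ℝ, 0 < K → ∀ ρ : ℝ → ℝ, S.IsGrowthBound α ρ → ∀ T x θhat μ,
        S.IsTrajectory ⟨α, β, K⟩ T x θhat μ → S.NBBound γ₁ γ₂ T θhat →
        ρ (Real.sqrt 2 * S.y0norm ⟨α, β, K⟩ (x 0) (θhat 0) (μ 0)) ^ 2 / 2 < min α (K - 1 / 2) →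
        (∃ M : ℝ, S.SignalsBounded ⟨α, β, K⟩ M T x θhat μ) ∧
        (T = ⊤ → Tendsto (fun t => ‖S.e t (x t)‖) atTop (𝓝 0))) ∧
      -- semi-global asymptotic tracking
      (∀ R : ℝ, 0 < R → ∃ K₀ : ℝ, 0 < K₀ ∧ ∀ K : ℝ, K₀ ≤ K → ∃ M : ℝ, ∀ T x θhat μ,
        S.IsTrajectory ⟨α, β, K⟩ T x θhat μ → S.NBBound γ₁ γ₂ T θhat →
        ‖S.e 0 (x 0)‖ ≤ R →
        S.SignalsBounded ⟨α, β, K⟩ M T x θhat μ ∧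
        (T = ⊤ → Tendsto (fun t => ‖S.e t (x t)‖) atTop (𝓝 0))) := by
  refine ⟨hS.exists_NBBound, fun α hα => hS.exists_isGrowthBound hα,
    fun α β γ₁ γ₂ hα hβ hγ₁ hγ₂ hgain => ⟨fun K _ ρ hρ T x θhat μ h hN hy => ?_, fun R hR => ?_⟩⟩
  · set s₀ := Real.sqrt 2 * S.y0norm ⟨α, β, K⟩ (x 0) (θhat 0) (μ 0) with hs₀def
    have hs₀ : 0 ≤ s₀ := mul_nonneg (Real.sqrt_nonneg _) (Real.sqrt_nonneg _)
    have hcont : ContinuousWithinAt (fun s => ρ s ^ 2 / 2) (Ioi s₀) s₀ :=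
      (((hρ.continuous s₀ hs₀).mono fun s hs => hs₀.trans (le_of_lt hs)).pow 2).div_const 2
    -- The strict inequality at s₀ persists at some s₁ > s₀ by continuity of ρ. Trapping needs this
    -- margin.
    obtain ⟨s₁, hs₁, hs⟩ :=
      ((hcont.eventually_lt_const hy).and self_mem_nhdsWithin).exists
    obtain ⟨M, hM⟩ := hS.exists_bound_of_decayOn hα hβ hγ₂ hgain (sub_pos.2 hs₁) hs₀ hs
      (hρ.decayOn s₁)
    obtain ⟨hb, ht⟩ := hM T x θhat μ h hN fun _ => le_rfl
    exact ⟨⟨M, hb⟩, ht⟩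
  · obtain ⟨s₀, hs₀, hy⟩ := hS.exists_y0norm_le (α := α) hβ hγ₁ hR
    obtain ⟨ρ, hρ⟩ := hS.exists_isGrowthBound hα
    -- Any radius above s₀ would do in place of s₀ + 1. As s₀ does not depend on K, this threshold
    -- is not circular.
    refine ⟨ρ (s₀ + 1) ^ 2 / (2 * α) + α, by positivity, fun K hK => ?_⟩
    obtain ⟨M, hM⟩ := hS.exists_bound_of_decayOn hα hβ hγ₂ hgain (half_pos hα) hs₀
      (lt_add_one s₀) (hρ.decayOn_of_large_gain hα _ hK)
    refine ⟨M, fun T x θhat μ h hN he => hM T x θhat μ h hN fun h0 => ?_⟩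
    rw [h.μ_zero]
    exact hy K _ _ he h.θhat_zero.le (hN.le 0 h0)
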